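/- Let $\beta\in\{1,2,4\}$ and let $\mathbb K=\mathbb R,\mathbb C,\mathbb H$ for $\beta=1,2,4$, respectively. Let $X$ be an $m\times n$ random matrix whose entries are i.i.d. centered normal random variables with values in $\mathbb K$ and $\mathbb E|X_{11}|^2=\beta$ (that is, all real coordinates of all entries are independent standard normal). Let $\Gamma$ be an $m\times m$ matrix, deterministic or random but independent of $X$, such that (almost surely) $\Gamma=-\Gamma^*$, $-i\Gamma\ge 0$, $\operatorname{rank}\Gamma=1$, $i\Gamma$ has entries in $\mathbb K$, and $\|\Gamma\|_{HS}=\big(\sum_{j,k}|\Gamma_{jk}|^2\big)^{1/2}=l$. For $\beta=4$ a quaternion $a+b\mathbf i+c\mathbf j+d\mathbf k$ is identified with the complex matrix $\begin{pmatrix}a+bi&c+di\\-c+di&a-bi\end{pmatrix}$, so that the scalar $i$ commutes with quaternions; the rank and the norm of $\Gamma$ are those of the quaternionic matrix $i\Gamma$ (rank over $\mathbb H$, moduli of quaternions), and complex scalars are identified with scalar multiples of the $2\times2$ identity. Put $$\widetilde H=\begin{pmatrix}\Gamma&X\\X^*&\mathbf 0_{n\times n}\end{pmatrix}.$$ Then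 there are real random variables $x_j$, $1\le j\le\min(m,n)$, and $y_j$, $1\le j\le\min(m-1,n)$, on the same probability space, mutually independent and jointly independent of $\Gamma$, with $$x_j\sim\chi_{\beta(n-j+1)},\qquad y_j\sim\chi_{\beta(m-j)},$$ where $\chi_\alpha$ has density $\frac{1}{2^{\alpha/2-1}\Gamma(\alpha/2)}x^{\alpha-1}e^{-x^2/2}$ on $x>0$, such that almost surely $\widetilde H$ is unitarily equivalent to $$J+i\,l\,I_{1\times1},$$ by a unitary matrix with entries in $\mathbb K$ (orthogonal, unitary, unitary symplectic for $\beta=1,2,4$). Here $I_{1\times1}$ is the $(m+n)\times(m+n)$ matrix with $1$ in the $(1,1)$ entry and $0$ elsewhere, and $J$ is the $(m+n)\times(m+n)$ real symmetric tridiagonal matrix with zero diagonal and off-diagonal entries $$x_1,y_1,x_2,\dots,y_{m-1},x_m,0,\dots,0\quad(m\le n),\qquad x_1,y_1,x_2,y_2,\dots,x_n,y_n,0,\dots,0\quad(m\ge n+1).$$ -/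

import Mathlib

open MeasureTheory ProbabilityTheory Matrix
open scoped ComplexOrder Quaternion Kronecker ENNReal

noncomputable section

/-- The chi distribution with parameter `α > 0`, with density
`x ^ (α - 1) * exp (-x ^ 2 / 2) / (2 ^ (α / 2 - 1) * Γ(α / 2))` on `x > 0`. -/
def chiMeasure (α : ℝ) : Measure ℝ :=
  volume.withDensity fun x =>
    if 0 < x then
      ENNReal.ofReal
        (1 / ((2 : ℝ) ^ (α / 2 - 1) * Real.Gamma (α / 2)) * x ^ (α - 1) * Real.exp (-x ^ 2 / 2))
    else 0

/-- The array of real coordinates of the entries of a matrix with entries in `K`. -/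
def realCoords {ι κ τ K : Type*} (coord : τ → K → ℝ) (A : Matrix ι κ K) : ι × κ × τ → ℝ :=
  fun p => coord p.2.2 (A p.1 p.2.1)

/-- Real coordinate of a real number. -/
def coordReal : Fin 1 → ℝ → ℝ := ![fun x => x]

/-- Real coordinates of a complex number. -/
def coordComplex : Fin 2 → ℂ → ℝ := ![fun z => z.re, fun z => z.im]

/-- Real coordinates of a quaternion. -/
def coordQuat : Fin 4 → ℍ[ℝ] → ℝ :=
  ![fun q => q.re, fun q => q.imI, fun q => q.imJ, fun q => q.imK]

/-- `X` is a random matrix whose entries are i.i.d. centered normal random variables with values in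
`K = ℝ, ℂ, ℍ` and `𝔼 |X j k| ^ 2 = β = 1, 2, 4`: all real coordinates of all
entries are independent standard real normal variables. -/
def IsGaussianMatrix {Ω K : Type*} [MeasurableSpace Ω] {m n d : ℕ} (coord : Fin d → K → ℝ)
    (X : Ω → Matrix (Fin m) (Fin n) K) (μ : Measure Ω) : Prop :=
  (∀ p, Measurable fun ω => realCoords coord (X ω) p) ∧
  (∀ p, HasLaw (fun ω => realCoords coord (X ω) p) (gaussianReal 0 1) μ) ∧
  iIndepFun (fun p ω => realCoords coord (X ω) p) μ

/-- The random variables `x₁, …, x_{min(m, n)}` and `y₁, …, y_{min(m - 1, n)}` are independent with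
`x_j ∼ χ_{β(n - j + 1)}` and `y_j ∼ χ_{β(m - j)}`. Indices start from `0` in the code. For `m ≤ n`
there are `m` of the `x_j` and `m - 1` of the `y_j`; for `m ≥ n + 1` there are `n` of each. -/
def IsChiFamily {Ω : Type*} [MeasurableSpace Ω] {m n : ℕ} (β : ℝ)
    (x : Fin (min m n) → Ω → ℝ) (y : Fin (min (m - 1) n) → Ω → ℝ) (μ : Measure Ω) : Prop :=
  (∀ j, Measurable (x j)) ∧ (∀ j, Measurable (y j)) ∧
  (∀ j, HasLaw (x j) (chiMeasure (β * ((n : ℝ) - (j : ℕ)))) μ) ∧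
  (∀ j, HasLaw (y j) (chiMeasure (β * ((m : ℝ) - 1 - (j : ℕ)))) μ) ∧
  iIndepFun (Sum.elim x y) μ

/-- The sequence `x₁, y₁, x₂, y₂, …`, indexed from `0` and continued by zeros. -/
def offDiag {m n : ℕ} (x : Fin (min m n) → ℝ) (y : Fin (min (m - 1) n) → ℝ) (k : ℕ) : ℝ :=
  if k % 2 = 0 then
    if h : k / 2 < min m n then x ⟨k / 2, h⟩ else 0
  else
    if h : k / 2 < min (m - 1) n then y ⟨k / 2, h⟩ else 0

/-- The symmetric tridiagonal matrix `J` of size `m + n` with zero diagonal. Its off-diagonal is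
`x₁, y₁, …, x_{m-1}, y_{m-1}, x_m, 0, …, 0` if `m ≤ n` and `x₁, y₁, …, x_n, y_n, 0, …, 0`
if `m ≥ n + 1`. -/
def chiralJ {m n : ℕ} (x : Fin (min m n) → ℝ) (y : Fin (min (m - 1) n) → ℝ) :
    Matrix (Fin (m + n)) (Fin (m + n)) ℝ :=
  Matrix.of fun i j =>
    if (i : ℕ) + 1 = j then offDiag x y i
    else if (j : ℕ) + 1 = i then offDiag x y j
    else 0

/-- The matrix `I_{1×1}`: entry `1` in the upper left corner, `0` everywhere else. -/
def cornerUnit (N : ℕ) : Matrix (Fin N) (Fin N) ℂ :=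
  Matrix.of fun i j => if (i : ℕ) = 0 ∧ (j : ℕ) = 0 then 1 else 0

/-- The matrix `J + i l I_{1×1}`. -/
def chiralJPert {m n : ℕ} (x : Fin (min m n) → ℝ) (y : Fin (min (m - 1) n) → ℝ) (l : ℝ) :
    Matrix (Fin (m + n)) (Fin (m + n)) ℂ :=
  (chiralJ x y).map Complex.ofReal + (Complex.I * (l : ℂ)) • cornerUnit (m + n)

/-- The Hilbert–Schmidt norm. -/
def hsNorm {ι K : Type*} [Fintype ι] [Norm K] (A : Matrix ι ι K) : ℝ :=
  Real.sqrt (∑ j, ∑ k, ‖A j k‖ ^ 2)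

/-- The block matrix with rows `(Γ, X)` and `(Xᴴ, 0)`, for complex matrices. -/
def chiralPert {m n : ℕ} (Γ : Matrix (Fin m) (Fin m) ℂ) (X : Matrix (Fin m) (Fin n) ℂ) :
    Matrix (Fin (m + n)) (Fin (m + n)) ℂ :=
  Matrix.reindex finSumFinEquiv finSumFinEquiv (Matrix.fromBlocks Γ X Xᴴ 0)

/-- The quaternion `a + b i + c j + d k` as a complex `2 × 2` matrix. -/
def quatBlock (q : ℍ[ℝ]) : Matrix (Fin 2) (Fin 2) ℂ :=
  !![⟨q.re, q.imI⟩, ⟨q.imJ, q.imK⟩; ⟨-q.imJ, q.imK⟩, ⟨q.re, -q.imI⟩]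

/-- A quaternionic matrix as a complex matrix of `2 × 2` blocks. -/
def quatMat {ι κ : Type*} (A : Matrix ι κ ℍ[ℝ]) : Matrix (ι × Fin 2) (κ × Fin 2) ℂ :=
  Matrix.of fun p q => quatBlock (A p.1 q.1) p.2 q.2

/-- The rank of a quaternionic matrix: the dimension of the right vector space over `ℍ` spanned by
its columns. -/
def quatRank {ι κ : Type*} (A : Matrix ι κ ℍ[ℝ]) : ℕ :=
  Module.finrank (ℍ[ℝ])ᵐᵒᵖ (Submodule.span (ℍ[ℝ])ᵐᵒᵖ (Set.range fun k : κ => fun j : ι => A j k))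

/-- The block matrix with rows `(Γ, X)` and `(X*, 0)` for quaternionic `X`, as a complex matrix of
`2 × 2` blocks. -/
def chiralPertQuat {m n : ℕ} (Γ : Matrix (Fin m × Fin 2) (Fin m × Fin 2) ℂ)
    (X : Matrix (Fin m) (Fin n) ℍ[ℝ]) :
    Matrix (Fin (m + n) × Fin 2) (Fin (m + n) × Fin 2) ℂ :=
  let e : (Fin m × Fin 2) ⊕ (Fin n × Fin 2) ≃ Fin (m + n) × Fin 2 :=
    (Equiv.sumProdDistrib (Fin m) (Fin n) (Fin 2)).symm.trans
      (finSumFinEquiv.prodCongr (Equiv.refl (Fin 2)))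
  Matrix.reindex e e (Matrix.fromBlocks Γ (quatMat X) (quatMat Xᴴ) 0)

end

/-! The argument is Householder reduction, run once for all three fields: `NormStar` records what is
needed of ℝ, ℂ and ℍ, namely that `star a * a` is the real, hence central, scalar `‖a‖ ^ 2`.

Put `B = -iΓ`, a positive rank-one matrix over `K` of norm `l`. The matrix in question is the chiral
block of `X` plus `i` times the block of `B`, so it suffices that a single unitary over `K` makes
the first summand tridiagonal and the second `l` times the corner unit. A Householder matrix `V`
built from a column of `B` turns `B` into `l e₁e₁*` and `X` into `VX`
(`IsRankOne.conj_householder`). The chiral block of `VX` is then reduced by a unitary that fixes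
`e₁`, so the corner survives (`exists_unitary_tridiagonal`). Each reduction step rotates the first
row to a multiple of the first basis vector, removes it, and continues with the conjugate transpose
of what is left; the row norms met on the way are the off-diagonal entries `bidiag`.

For the laws, `V` depends on `Γ` only. The Gaussian law is invariant under unitaries, so `VX` is
Gaussian and independent of `Γ` (`IndepFun.fiberwise_measurePreserving`). In the same way each
rotation depends only on the removed row and leaves the other rows Gaussian and independent of it.
The entries are therefore independent norms of standard Gaussian vectors (`map_bidiag`), and polar
coordinates identify those norms as chi variables (`map_norm_stdGaussian`). The rows have lengths
`n, m - 1, n - 1, m - 2, …`, which gives the stated parameters. -/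

/-- A normed real division algebra whose involution satisfies `star a * a = ‖a‖ ^ 2`. -/
class NormStar (K : Type*) [NormedDivisionRing K] [StarRing K] [InnerProductSpace ℝ K] : Prop where
  star_mul_self (a : K) : star a * a = (‖a‖ ^ 2 : ℝ) • (1 : K)

set_option linter.unusedSectionVars false

/-! ### Householder matrices over ℝ, ℂ and ℍ -/

namespace NormStar

noncomputable section

variable {K : Type*} [NormedDivisionRing K] [StarRing K] [InnerProductSpace ℝ K]
  [IsScalarTower ℝ K K] [SMulCommClass ℝ K K] [StarModule ℝ K] [NormStar K]
variable {ι κ : Type*} [Fintype ι] [Fintype κ] [DecidableEq ι]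

lemma smul_one_injective {r s : ℝ} (h : r • (1 : K) = s • (1 : K)) : r = s :=
  smul_left_injective ℝ one_ne_zero h

lemma norm_smul_one (r : ℝ) : ‖r • (1 : K)‖ = |r| := by
  rw [norm_smul, norm_one, mul_one, Real.norm_eq_abs]

lemma norm_star' (a : K) : ‖star a‖ = ‖a‖ := by
  by_cases h : a = 0
  · simp [h]
  have := congrArg norm (NormStar.star_mul_self a)
  rw [norm_mul, norm_smul_one, abs_of_nonneg (by positivity), sq] at this
  exact mul_right_cancel₀ (norm_ne_zero_iff.2 h) this

lemma mul_star_self' (a : K) : a * star a = (‖a‖ ^ 2 : ℝ) • (1 : K) := by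
  have := NormStar.star_mul_self (star a)
  rwa [star_star, norm_star'] at this

/-- The sum of the squared norms of the coordinates of a vector. -/
def sqSum (v : ι → K) : ℝ := ∑ i, ‖v i‖ ^ 2

lemma sqSum_nonneg (v : ι → K) : 0 ≤ sqSum v := Finset.sum_nonneg fun _ _ => by positivity

lemma sqSum_eq_zero {v : ι → K} (h : sqSum v = 0) : v = 0 := by
  ext i
  have := (Finset.sum_eq_zero_iff_of_nonneg (fun i _ => by positivity)).1 h i (Finset.mem_univ i)
  simpa using this

lemma sqSum_star (v : ι → K) : sqSum (star v) = sqSum v := by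
  simp [sqSum, norm_star']

lemma star_dotProduct_self (v : ι → K) : star v ⬝ᵥ v = sqSum v • (1 : K) := by
  simp [dotProduct, sqSum, NormStar.star_mul_self, Finset.sum_smul]

/-- The reflection in the hyperplane orthogonal to `w`. -/
def reflection (w : ι → K) : Matrix ι ι K :=
  1 - (2 / sqSum w) • vecMulVec w (star w)

lemma conjTranspose_reflection (w : ι → K) : (reflection w)ᴴ = reflection w := by
  ext i j
  simp [reflection, vecMulVec_apply, Matrix.one_apply, eq_comm, apply_ite star]

lemma reflection_mul_self (w : ι → K) : reflection w * reflection w = 1 := by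
  have h : vecMulVec w (star w) * vecMulVec w (star w) =
      sqSum w • vecMulVec w (star w) := by
    ext i j
    have : ∑ k, w i * star (w k) * (w k * star (w j)) =
        w i * (star w ⬝ᵥ w) * star (w j) := by
      simp [dotProduct, Finset.mul_sum, Finset.sum_mul, mul_assoc]
    simp only [Matrix.mul_apply, vecMulVec_apply, Pi.star_apply, this, star_dotProduct_self,
      Matrix.smul_apply, mul_smul_comm, smul_mul_assoc, mul_one]
  by_cases hs : sqSum w = 0
  -- Here `2 / 0 = 0`, so the reflection is the identity. No case distinction is needed in the
  -- definition.
  · simp [reflection, hs]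
  simp only [reflection, Matrix.sub_mul, Matrix.mul_sub, Matrix.one_mul, Matrix.mul_one,
    Matrix.smul_mul, Matrix.mul_smul, h, smul_smul]
  rw [sub_sub, sub_eq_self, div_mul_cancel₀ _ hs, smul_sub, smul_smul, ← sub_smul, ← add_smul,
    show 2 / sqSum w + (2 / sqSum w - 2 / sqSum w * 2) = 0 by ring, zero_smul]

/-- The inner product is assumed real because the phase in `householder` is chosen to make it so; a
real scalar commutes with everything, also over ℍ. -/
lemma reflection_mulVec {w v : ι → K} {c : ℝ} (h : star w ⬝ᵥ v = c • (1 : K)) (i : ι) :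
    (reflection w *ᵥ v) i = v i - (2 / sqSum w * c) • w i := by
  have : (vecMulVec w (star w) *ᵥ v) i = w i * (star w ⬝ᵥ v) := by
    simp [mulVec, dotProduct, vecMulVec_apply, Finset.mul_sum, mul_assoc]
  rw [reflection, Matrix.sub_mulVec, Matrix.smul_mulVec, Pi.sub_apply, Pi.smul_apply, this, h,
    Matrix.one_mulVec]
  simp [smul_smul]

open Classical in
/-- The phase of an element: a unit `u` with `star u * a = ‖a‖`. -/
def phase (a : K) : K := if a = 0 then 1 else ‖a‖⁻¹ • a

lemma star_phase_mul (a : K) : star (phase a) * a = ‖a‖ • (1 : K) := by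
  by_cases h : a = 0
  · simp [h]
  have : ‖a‖ ≠ 0 := norm_ne_zero_iff.2 h
  simp only [phase, h, if_false, star_smul, star_trivial, smul_mul_assoc, NormStar.star_mul_self,
    smul_smul]
  congr 1
  field_simp

lemma norm_phase (a : K) : ‖phase a‖ = 1 := by
  by_cases h : a = 0
  · simp [phase, h]
  · simp [phase, h, norm_smul]

/-- A unitary matrix that maps `v` to a nonnegative multiple of the first basis vector. -/
def householder : ∀ {n : ℕ}, (Fin n → K) → Matrix (Fin n) (Fin n) K
  | 0, _ => 1
  | _ + 1, v => diagonal (Fin.cons (-star (phase (v 0))) fun _ => 1) *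
      reflection (v + Pi.single 0 (√(sqSum v) • phase (v 0)))

lemma diagonal_cons_mul {n : ℕ} {a b : K} (h : a * b = 1) :
    diagonal (Fin.cons a fun _ : Fin n => (1 : K)) * diagonal (Fin.cons b fun _ : Fin n => (1 : K))
      = 1 := by
  rw [diagonal_mul_diagonal, ← diagonal_one]
  congr 1
  ext i
  refine Fin.cases ?_ (fun _ => ?_) i <;> simp [h]

lemma conjTranspose_diagonal_cons {n : ℕ} (a : K) :
    (diagonal (Fin.cons a fun _ : Fin n => (1 : K)))ᴴ =
      diagonal (Fin.cons (star a) fun _ : Fin n => (1 : K)) := by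
  rw [diagonal_conjTranspose]
  congr 1
  ext i
  refine Fin.cases ?_ (fun _ => ?_) i <;> simp

lemma householder_mul_conjTranspose {n : ℕ} (v : Fin n → K) :
    householder v * (householder v)ᴴ = 1 := by
  classical
  cases n with
  | zero => simp [householder]
  | succ n =>
    rw [householder, conjTranspose_mul, conjTranspose_reflection, conjTranspose_diagonal_cons,
      Matrix.mul_assoc, ← Matrix.mul_assoc (reflection _), reflection_mul_self, Matrix.one_mul,
      diagonal_cons_mul]
    simp [NormStar.star_mul_self, norm_phase]

lemma conjTranspose_mul_householder {n : ℕ} (v : Fin n → K) :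
    (householder v)ᴴ * householder v = 1 := by
  classical
  cases n with
  | zero => simp [householder]
  | succ n =>
    rw [householder, conjTranspose_mul, conjTranspose_reflection, conjTranspose_diagonal_cons,
      Matrix.mul_assoc, ← Matrix.mul_assoc (diagonal _), diagonal_cons_mul, Matrix.one_mul,
      reflection_mul_self]
    simp [mul_star_self', norm_phase]

lemma householder_mulVec {n : ℕ} (v : Fin n → K) (i : Fin n) :
    (householder v *ᵥ v) i = if (i : ℕ) = 0 then √(sqSum v) • (1 : K) else 0 := by
  classical
  cases n with
  | zero => exact i.elim0
  | succ n =>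
    by_cases hv : v = 0
    · simp [hv, sqSum]
    have ha0 : sqSum v ≠ 0 := fun h => hv (sqSum_eq_zero h)
    set a := √(sqSum v) with ha
    have hapos : 0 < a := Real.sqrt_pos.2 (lt_of_le_of_ne (sqSum_nonneg v) ha0.symm)
    have hsq : sqSum v = a ^ 2 := (Real.sq_sqrt (sqSum_nonneg v)).symm
    set u := phase (v 0) with hu
    set w := v + Pi.single 0 (a • u) with hw
    -- The phase of the added term is that of `v 0`, so the two contributions are nonnegative reals
    -- and cannot cancel.
    have h1 : star w ⬝ᵥ v = (a ^ 2 + a * ‖v 0‖) • (1 : K) := by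
      have : star w = star v + Pi.single 0 (a • star u) := by
        ext i; refine Fin.cases ?_ (fun _ => ?_) i <;> simp [hw]
      rw [this, add_dotProduct, star_dotProduct_self, single_dotProduct, smul_mul_assoc, hu,
        star_phase_mul, hsq, smul_smul, add_smul]
    have h2 : star w ⬝ᵥ w = (2 * (a ^ 2 + a * ‖v 0‖)) • (1 : K) := by
      have e : star (v 0) * u = ‖v 0‖ • (1 : K) := by
        have := congrArg star (star_phase_mul (v 0))
        simpa using this
      have e' : star w 0 * (a • u) = (a * ‖v 0‖ + a ^ 2) • (1 : K) := by
        have e2 : star u * u = (1 : K) := by simp [NormStar.star_mul_self, hu, norm_phase]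
        simp only [hw, Pi.star_apply, Pi.add_apply, Pi.single_eq_same, star_add, star_smul,
          star_trivial, add_mul, mul_smul_comm, smul_mul_assoc, e, e2, smul_add, smul_smul]
        rw [← add_smul, sq]
      conv_lhs => rw [hw, dotProduct_add, ← hw, h1, dotProduct_single, e', ← add_smul]
      congr 1
      ring
    have h3 : sqSum w = 2 * (a ^ 2 + a * ‖v 0‖) :=
      smul_one_injective ((star_dotProduct_self w).symm.trans h2)
    -- By `h1` and `h3`, `w` has squared norm twice its inner product with `v`, so the coefficient
    -- of `w` is one and the image is `v - w`.
    have h4 : reflection w *ᵥ v = Pi.single 0 (-(a • u)) := by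
      ext i
      rw [reflection_mulVec h1, h3]
      have : 2 / (2 * (a ^ 2 + a * ‖v 0‖)) * (a ^ 2 + a * ‖v 0‖) = 1 := by
        have : 0 < a ^ 2 + a * ‖v 0‖ := by positivity
        field_simp
      rw [this, one_smul]
      refine Fin.cases ?_ (fun _ => ?_) i <;> simp [hw]
    -- The diagonal factor `-star u` cancels the remaining phase `-u`.
    rw [householder, ← Matrix.mulVec_mulVec, h4]
    refine Fin.cases ?_ (fun _ => ?_) i
    · simp [mulVec_diagonal, NormStar.star_mul_self, norm_phase, hu, mul_smul_comm]
    · simp [mulVec_diagonal]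

/-! ### Deterministic reduction to tridiagonal form -/

/-- The off-diagonal entries produced by alternately reducing the first row and the first column
of a matrix by unitary matrices. -/
def bidiag : ℕ → ∀ m n : ℕ, (Fin m → Fin n → K) → ℝ
  | _, 0, _, _ => 0
  | 0, _ + 1, _, X => √(sqSum (X 0))
  | k + 1, m + 1, n, X =>
      bidiag k n m (householder (star (X 0)) * (Matrix.of fun i : Fin m => X i.succ)ᴴ)

/-- The symmetric tridiagonal matrix with zero diagonal and off-diagonal entries `z`. -/
def triJ (N : ℕ) (z : ℕ → ℝ) : Matrix (Fin N) (Fin N) K :=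
  Matrix.of fun i j =>
    (if (i : ℕ) + 1 = j then z i else if (j : ℕ) + 1 = i then z j else 0) • (1 : K)

/-- Split off the first element of `Fin (m + 1)`, and exchange the remaining summands. -/
def swapSuccEquiv (m n : ℕ) : Unit ⊕ (Fin n ⊕ Fin m) ≃ Fin (m + 1) ⊕ Fin n where
  toFun := Sum.elim (fun _ => Sum.inl 0) (Sum.elim Sum.inr fun a => Sum.inl a.succ)
  invFun := Sum.elim (Fin.cases (Sum.inl ()) fun a => Sum.inr (Sum.inr a))
    fun b => Sum.inr (Sum.inl b)
  left_inv := by rintro (_ | _ | _) <;> rfl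
  right_inv := by
    rintro (a | _)
    · refine Fin.cases ?_ (fun _ => ?_) a <;> rfl
    · rfl

/-- Split off the first element of `Fin (N + 1)`. -/
def unitSumFinEquiv (N : ℕ) : Unit ⊕ Fin N ≃ Fin (N + 1) where
  toFun := Sum.elim (fun _ => 0) Fin.succ
  invFun := Fin.cases (Sum.inl ()) Sum.inr
  left_inv := by rintro (_ | _) <;> rfl
  right_inv := by
    intro a
    refine Fin.cases ?_ (fun _ => ?_) a <;> rfl

/-- The block matrix with rows `(0, X)` and `(Xᴴ, 0)`. -/
def chiralBlock {m n : ℕ} (X : Matrix (Fin m) (Fin n) K) :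
    Matrix (Fin m ⊕ Fin n) (Fin m ⊕ Fin n) K :=
  fromBlocks 0 X Xᴴ 0

lemma conj_submatrix {l l' k k' : Type*} [Fintype l] [Fintype l'] [Fintype k] [Fintype k']
    (e : l ≃ l') (f : k ≃ k') (U : Matrix l k K) (H : Matrix k' k' K) :
    U.submatrix e.symm f.symm * H * (U.submatrix e.symm f.symm)ᴴ =
      (U * H.submatrix f f * Uᴴ).submatrix e.symm e.symm := by
  have : H = (H.submatrix f f).submatrix f.symm f.symm := by simp
  conv_lhs => rw [this]
  rw [conjTranspose_submatrix, submatrix_mul_equiv, submatrix_mul_equiv]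

lemma isometry_submatrix {l l' k k' : Type*} [Fintype l] [Fintype l'] [Fintype k] [Fintype k']
    [DecidableEq l] [DecidableEq l']
    (e : l ≃ l') (f : k ≃ k') {U : Matrix l k K} (h : U * Uᴴ = 1) :
    U.submatrix e.symm f.symm * (U.submatrix e.symm f.symm)ᴴ = 1 := by
  rw [conjTranspose_submatrix, submatrix_mul_equiv, h, submatrix_one_equiv]

lemma fromBlocks_conj_chiralBlock {m n : ℕ} (V : Matrix (Fin m) (Fin m) K)
    (X : Matrix (Fin m) (Fin n) K) :
    fromBlocks V 0 0 (1 : Matrix (Fin n) (Fin n) K) * chiralBlock X *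
      (fromBlocks V 0 0 (1 : Matrix (Fin n) (Fin n) K))ᴴ = chiralBlock (V * X) := by
  simp [chiralBlock, fromBlocks_multiply, fromBlocks_conjTranspose]

lemma fromBlocks_mul_conjTranspose {l m k : Type*} [Fintype m] [Fintype k] [Fintype l]
    [DecidableEq l] [DecidableEq m]
    {V : Matrix m k K} (h : V * Vᴴ = 1) :
    fromBlocks V 0 0 (1 : Matrix l l K) * (fromBlocks V 0 0 (1 : Matrix l l K))ᴴ = 1 := by
  simp [fromBlocks_multiply, fromBlocks_conjTranspose, h]

lemma fromBlocks_one_mul_conjTranspose {l m k : Type*} [Fintype m] [Fintype k] [Fintype l]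
    [DecidableEq l] [DecidableEq m]
    {V : Matrix m k K} (h : V * Vᴴ = 1) :
    fromBlocks (1 : Matrix l l K) 0 0 V * (fromBlocks (1 : Matrix l l K) 0 0 V)ᴴ = 1 := by
  simp [fromBlocks_multiply, fromBlocks_conjTranspose, h]

lemma mul_mul_conjTranspose_eq_one {l m k : Type*} [Fintype m] [Fintype k] [Fintype l]
    [DecidableEq l] [DecidableEq m] {U : Matrix l m K} {V : Matrix m k K}
    (hU : U * Uᴴ = 1) (hV : V * Vᴴ = 1) : U * V * (U * V)ᴴ = 1 := by
  rw [conjTranspose_mul, Matrix.mul_assoc, ← Matrix.mul_assoc V, hV, Matrix.one_mul, hU]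

lemma mul_conj_mul {l m k : Type*} [Fintype m] [Fintype k] (U : Matrix l m K) (V : Matrix m k K)
    (H : Matrix k k K) : U * V * H * (U * V)ᴴ = U * (V * H * Vᴴ) * Uᴴ := by
  simp only [conjTranspose_mul, Matrix.mul_assoc]

lemma triJ_succ (N : ℕ) (z : ℕ → ℝ) :
    (triJ (N + 1) z : Matrix _ _ K) =
      (fromBlocks 0 (of fun (i : Fin N) (_ : Unit) => if (i : ℕ) = 0 then z 0 • (1 : K) else 0)ᴴ
        (of fun (i : Fin N) (_ : Unit) => if (i : ℕ) = 0 then z 0 • (1 : K) else 0)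
        (triJ N fun k => z (k + 1))).submatrix
        (unitSumFinEquiv N).symm (unitSumFinEquiv N).symm := by
  ext i j
  obtain ⟨i, rfl⟩ := (unitSumFinEquiv N).surjective i
  obtain ⟨j, rfl⟩ := (unitSumFinEquiv N).surjective j
  rcases i with _ | i <;> rcases j with _ | j <;>
    simp [unitSumFinEquiv, triJ, apply_ite star, ite_smul, eq_comm]

/-- This makes the induction close: the Householder factor turns the split-off row into a multiple
of the first basis vector, and `U` keeps that vector in first place. The border of the remaining
block thus has one nonzero entry at most. For `n = 0` the row is empty and both sides vanish. -/
lemma householder_row {m n N : ℕ} (hN : N = n + m) (r : Fin n → K)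
    {U : Matrix (Fin N) (Fin n ⊕ Fin m) K}
    (hU : ∀ (a : Fin n) (i : Fin N), (a : ℕ) = 0 → U i (Sum.inl a) = if (i : ℕ) = 0 then 1 else 0) :
    U * fromBlocks (householder (star r)) 0 0 (1 : Matrix (Fin m) (Fin m) K) *
      (of fun _ : Unit => Sum.elim r (0 : Fin m → K))ᴴ =
    of fun (i : Fin N) (_ : Unit) => if (i : ℕ) = 0 then √(sqSum r) • (1 : K) else 0 := by
  have h : fromBlocks (householder (star r)) 0 0 (1 : Matrix (Fin m) (Fin m) K) *
      (of fun _ : Unit => Sum.elim r (0 : Fin m → K))ᴴ =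
      of fun a (_ : Unit) => Sum.elim
        (fun b : Fin n => if (b : ℕ) = 0 then √(sqSum r) • (1 : K) else 0) 0 a := by
    ext a u
    rcases a with a | a
    · have := householder_mulVec (star r) a
      simpa [Matrix.mul_apply, mulVec, dotProduct, sqSum_star] using this
    · simp [Matrix.mul_apply, Matrix.one_apply]
  rw [Matrix.mul_assoc, h]
  ext i u
  cases n with
  | zero => simp [Matrix.mul_apply, sqSum]
  | succ n => simp [Matrix.mul_apply, hU 0 i rfl]

/-- Removing the first row leaves a chiral block with `m` and `n` exchanged, so the induction runs
on the total size `N`, kept as a separate variable. The last clause, that the first basis vector is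
fixed, strengthens the induction hypothesis for `householder_row` and later preserves the corner
perturbation. -/
theorem exists_unitary_tridiagonal (N : ℕ) : ∀ (m n : ℕ), N = m + n → ∀ X : Fin m → Fin n → K,
    ∃ U : Matrix (Fin N) (Fin m ⊕ Fin n) K, U * Uᴴ = 1 ∧ Uᴴ * U = 1 ∧
      U * chiralBlock (of X) * Uᴴ = triJ N (fun k => bidiag k m n X) ∧
      ∀ (a : Fin m) (i : Fin N), (a : ℕ) = 0 →
        U i (Sum.inl a) = if (i : ℕ) = 0 then 1 else 0 := by
  induction N with
  | zero =>
    intro m n h X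
    obtain ⟨rfl, rfl⟩ : m = 0 ∧ n = 0 := by omega
    refine ⟨0, ?_, ?_, ?_, fun a => a.elim0⟩ <;> ext i <;>
      first | exact i.elim0 | (rcases i with i | i <;> exact i.elim0)
  | succ N ih =>
    intro m n h X
    cases m with
    | zero =>
      have e : Fin (N + 1) ≃ Fin 0 ⊕ Fin n :=
        (finCongr (by omega)).trans (Equiv.emptySum (Fin 0) (Fin n)).symm
      refine ⟨(1 : Matrix _ _ K).submatrix e id, ?_, ?_, ?_, fun a => a.elim0⟩
      · rw [conjTranspose_submatrix, conjTranspose_one, ← Equiv.coe_refl, submatrix_mul_equiv,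
          Matrix.one_mul, submatrix_one_equiv]
      · rw [conjTranspose_submatrix, conjTranspose_one, submatrix_mul_equiv,
          Matrix.one_mul, submatrix_id_id]
      · have h0 : chiralBlock (of X) = 0 := by
          ext i j
          rcases i with i | i
          · exact i.elim0
          · rcases j with j | j
            · exact j.elim0
            · rfl
        have hJ : (triJ (N + 1) (fun k => bidiag k 0 n X) : Matrix _ _ K) = 0 := by
          ext i j
          simp [triJ, bidiag]
        rw [h0, hJ, Matrix.mul_zero, Matrix.zero_mul]
    | succ m =>
      have hN : N = n + m := by omega
      set R : Matrix (Fin m) (Fin n) K := of fun i => X i.succ with hR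
      set V := householder (star (X 0)) with hV
      obtain ⟨U, h1, h2, h3, h4⟩ := ih n m hN (V * Rᴴ)
      set Q := U * fromBlocks V 0 0 (1 : Matrix (Fin m) (Fin m) K) with hQ
      set ρ : Matrix Unit (Fin n ⊕ Fin m) K := of fun _ : Unit => Sum.elim (X 0) (0 : Fin m → K)
        with hρ
      have hQ1 : Q * Qᴴ = 1 := mul_mul_conjTranspose_eq_one h1
        (fromBlocks_mul_conjTranspose (householder_mul_conjTranspose _))
      have hQ2 : Qᴴ * Q = 1 := by
        have := mul_mul_conjTranspose_eq_one (U := (fromBlocks V 0 0 (1 : Matrix (Fin m) (Fin m) K))ᴴ)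
          (V := Uᴴ) ?_ (by rwa [conjTranspose_conjTranspose])
        · rwa [← conjTranspose_mul, conjTranspose_conjTranspose] at this
        · rw [fromBlocks_conjTranspose]
          simpa using fromBlocks_mul_conjTranspose (l := Fin m) (V := Vᴴ)
            (by rw [conjTranspose_conjTranspose]; exact conjTranspose_mul_householder _)
      have hρQ := householder_row hN (X 0) h4
      rw [← hV, ← hQ, ← hρ] at hρQ
      -- With the removed row in front and columns listed before the remaining rows, the matrix is
      -- the chiral block of `Rᴴ` bordered by `ρ`.
      have hblock : (chiralBlock (of X)).submatrix (swapSuccEquiv m n) (swapSuccEquiv m n) =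
          fromBlocks 0 ρ ρᴴ (chiralBlock Rᴴ) := by
        ext i j
        rcases i with i | i | i <;> rcases j with j | j | j <;>
          simp [chiralBlock, swapSuccEquiv, hρ, hR]
      refine ⟨(fromBlocks (1 : Matrix Unit Unit K) 0 0 Q).submatrix (unitSumFinEquiv N).symm
        (swapSuccEquiv m n).symm, ?_, ?_, ?_, ?_⟩
      · exact isometry_submatrix _ _ (fromBlocks_one_mul_conjTranspose hQ1)
      · rw [conjTranspose_submatrix, submatrix_mul_equiv, fromBlocks_conjTranspose,
          fromBlocks_multiply]
        simp [hQ2]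
      · rw [conj_submatrix, hblock, triJ_succ]
        congr 1
        rw [fromBlocks_conjTranspose, fromBlocks_multiply, fromBlocks_multiply]
        have hQρ := congrArg conjTranspose hρQ
        rw [conjTranspose_mul, conjTranspose_conjTranspose] at hQρ
        have hlow : Q * chiralBlock Rᴴ * Qᴴ = triJ N fun k => bidiag (k + 1) (m + 1) n X := by
          rw [hQ, mul_conj_mul, fromBlocks_conj_chiralBlock]
          exact h3
        simp only [Matrix.one_mul, Matrix.zero_mul, Matrix.mul_zero, add_zero, zero_add,
          conjTranspose_zero, conjTranspose_one, Matrix.mul_one, hlow, hρQ, hQρ]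
        rfl
      · intro a i ha
        obtain rfl : a = 0 := Fin.ext ha
        refine Fin.cases ?_ (fun i => ?_) i
        · simp [unitSumFinEquiv, swapSuccEquiv]
        · simp [unitSumFinEquiv, swapSuccEquiv]

/-! ### Rank-one perturbations -/

/-- The first column of `B` whose diagonal entry does not vanish. -/
def pivotCol {m : ℕ} (B : Fin m → Fin m → K) (j : Fin m) : K :=
  open Classical in ∑ k, if B k k ≠ 0 ∧ ∀ i < k, B i i = 0 then B j k else 0

/-- Exactly one summand of `pivotCol` survives. Taking the first admissible index, instead of an
arbitrary one, makes the column a measurable function of `B`. -/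
lemma exists_pivotCol_eq {m : ℕ} {B : Fin m → Fin m → K} (h : ∃ k, B k k ≠ 0) :
    ∃ k, B k k ≠ 0 ∧ pivotCol B = fun j => B j k := by
  classical
  obtain ⟨k, hk, hmin⟩ := WellFounded.has_min (wellFounded_lt (α := Fin m)) {k | B k k ≠ 0} h
  refine ⟨k, hk, funext fun j => ?_⟩
  have hk' : B k k ≠ 0 ∧ ∀ i < k, B i i = 0 :=
    ⟨hk, fun i hi => by_contra fun hB => hmin i hB hi⟩
  rw [pivotCol, Finset.sum_eq_single k, if_pos hk']
  · rintro i - hik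
    rw [if_neg]
    rintro ⟨hi, hi'⟩
    rcases lt_or_gt_of_ne hik with h | h
    · exact hi (hk'.2 i h)
    · exact hk (hi' k h)
  · simp

/-- A nonzero positive semidefinite matrix of rank one with Hilbert–Schmidt norm `l`. -/
structure IsRankOne {m : ℕ} (B : Matrix (Fin m) (Fin m) K) (l : ℝ) : Prop where
  isHermitian : ∀ j k, star (B j k) = B k j
  diag_nonneg : ∀ k, ∃ r : ℝ, 0 ≤ r ∧ B k k = r • (1 : K)
  ne_zero : B ≠ 0
  minor : ∀ i j k, B i k * B k j = B k k * B i j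
  norm_eq : hsNorm B = l

/-- The matrix with upper left entry `l` and all other entries `0`. -/
def corner (N : ℕ) (l : ℝ) : Matrix (Fin N) (Fin N) K :=
  of fun i j => if (i : ℕ) = 0 ∧ (j : ℕ) = 0 then l • (1 : K) else 0

/-- With `v` the pivot column and `r > 0` its diagonal entry, the minor condition reads `B = r⁻¹ v
v*`. Hence `l = r⁻¹ ‖v‖ ^ 2`, and sending `v` to `‖v‖ e₁` sends `B` to `l e₁e₁*`. -/
lemma IsRankOne.conj_householder {m : ℕ} {B : Matrix (Fin m) (Fin m) K} {l : ℝ}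
    (hB : IsRankOne B l) :
    householder (pivotCol B) * B * (householder (pivotCol B))ᴴ = corner m l := by
  -- If the diagonal vanished, the minors `B k j * B j k = B j j * B k k` would give `‖B j k‖ ^ 2 =
  -- 0` throughout.
  have hdiag : ∃ k, B k k ≠ 0 := by
    by_contra! h
    refine hB.ne_zero (Matrix.ext fun j k => ?_)
    have := hB.minor k k j
    rw [h j, zero_mul, ← hB.isHermitian, NormStar.star_mul_self] at this
    simpa using congrArg norm this
  obtain ⟨k, hk, hv⟩ := exists_pivotCol_eq hdiag
  rw [hv]
  set v : Fin m → K := fun j => B j k with hvdef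
  obtain ⟨r, hr, hrk⟩ := hB.diag_nonneg k
  have hr0 : r ≠ 0 := by rintro rfl; simp [hrk] at hk
  have hrpos : 0 < r := lt_of_le_of_ne hr hr0.symm
  have hBv : ∀ i j, B i j = r⁻¹ • (v i * star (v j)) := by
    intro i j
    rw [hvdef, hB.isHermitian, hB.minor, hrk, smul_mul_assoc, one_mul, smul_smul,
      inv_mul_cancel₀ hr0, one_smul]
  have hl : l = r⁻¹ * sqSum v := by
    rw [← hB.norm_eq, hsNorm]
    have : ∑ i, ∑ j, ‖B i j‖ ^ 2 = (r⁻¹ * sqSum v) ^ 2 := by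
      rw [mul_pow, sq (sqSum v), sqSum, Finset.sum_mul_sum, Finset.mul_sum]
      refine Finset.sum_congr rfl fun i _ => ?_
      rw [Finset.mul_sum]
      refine Finset.sum_congr rfl fun j _ => ?_
      rw [hBv, norm_smul, norm_mul, norm_star', Real.norm_of_nonneg (by positivity)]
      ring
    rw [this, Real.sqrt_sq (mul_nonneg (by positivity) (sqSum_nonneg v))]
  set V := householder v
  have hcol : B = r⁻¹ • (replicateCol Unit v * (replicateCol Unit v)ᴴ) := by
    ext i j
    rw [hBv, Matrix.smul_apply]
    simp [Matrix.mul_apply]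
  have hVcol : ∀ i u, (V * replicateCol Unit v) i u =
      if (i : ℕ) = 0 then √(sqSum v) • (1 : K) else 0 := by
    intro i u
    rw [← householder_mulVec]
    rfl
  rw [hcol, Matrix.mul_smul, Matrix.smul_mul, ← Matrix.mul_assoc, Matrix.mul_assoc _ _ Vᴴ,
    ← conjTranspose_mul]
  ext i j
  rw [Matrix.smul_apply, Matrix.mul_apply]
  simp only [conjTranspose_apply, hVcol, corner, of_apply, hl]
  by_cases hi : (i : ℕ) = 0 <;> by_cases hj : (j : ℕ) = 0 <;>
    simp [hi, hj, smul_smul, Real.mul_self_sqrt (sqSum_nonneg v)]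

/-- The two identities are kept apart because the scalar `i` that multiplies `B` does not act on
matrices over `K` in the real and quaternionic cases. They are recombined over ℂ at the end. -/
theorem exists_unitary_tridiagonal_corner {m n : ℕ} (X : Fin m → Fin n → K)
    {B : Matrix (Fin m) (Fin m) K} {l : ℝ} (hB : IsRankOne B l) :
    ∃ U ∈ unitary (Matrix (Fin (m + n)) (Fin (m + n)) K),
      U * reindex finSumFinEquiv finSumFinEquiv (chiralBlock (of X)) * Uᴴ =
        triJ (m + n) (fun k => bidiag k m n (householder (pivotCol B) * of X)) ∧
      U * reindex finSumFinEquiv finSumFinEquiv (fromBlocks B 0 0 0) * Uᴴ =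
        corner (m + n) l := by
  set V := householder (pivotCol B) with hV
  obtain ⟨U, h1, h2, h3, h4⟩ := exists_unitary_tridiagonal (m + n) m n rfl (V * of X)
  set e : Fin m ⊕ Fin n ≃ Fin (m + n) := finSumFinEquiv
  set Q := U * fromBlocks V 0 0 (1 : Matrix (Fin n) (Fin n) K) with hQ
  have hQ1 : Q * Qᴴ = 1 := mul_mul_conjTranspose_eq_one h1
    (fromBlocks_mul_conjTranspose (householder_mul_conjTranspose _))
  have hconj := fun H => conj_submatrix (Equiv.refl (Fin (m + n))) e Q H
  have hU1 := isometry_submatrix (Equiv.refl (Fin (m + n))) e hQ1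
  refine ⟨Q.submatrix (Equiv.refl _).symm e.symm, ?_, ?_, ?_⟩
  · exact Unitary.mem_iff.2 ⟨mul_eq_one_comm.1 hU1, hU1⟩
  · rw [hconj, reindex_apply, submatrix_submatrix]
    simp only [Equiv.symm_comp_self, submatrix_id_id, Equiv.refl_symm, Equiv.coe_refl]
    rw [hQ, mul_conj_mul, fromBlocks_conj_chiralBlock]
    exact h3
  · rw [hconj, reindex_apply, submatrix_submatrix]
    simp only [Equiv.symm_comp_self, submatrix_id_id, Equiv.refl_symm, Equiv.coe_refl]
    rw [hQ, mul_conj_mul]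
    have : fromBlocks V 0 0 (1 : Matrix (Fin n) (Fin n) K) * fromBlocks B 0 0 0 *
        (fromBlocks V 0 0 (1 : Matrix (Fin n) (Fin n) K))ᴴ = fromBlocks (corner m l) 0 0 0 := by
      rw [← hB.conj_householder]
      simp [fromBlocks_multiply, fromBlocks_conjTranspose, hV]
    rw [this]
    cases m with
    | zero => exact absurd (Subsingleton.elim _ _) hB.ne_zero
    | succ m =>
      -- Only the column of `U` at the first row index meets the corner, and by `h4` that column is
      -- the first basis vector.
      ext i j
      by_cases hi : i = 0 <;> by_cases hj : j = 0 <;>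
        simp [Matrix.mul_apply, corner, Fin.sum_univ_succ, h4 0 _ rfl, hi, hj]

end

end NormStar

noncomputable section

/-! ### The norm of a standard Gaussian vector -/

section Chi

open Real Complex Module

variable {E : Type*} [NormedAddCommGroup E] [InnerProductSpace ℝ E] [FiniteDimensional ℝ E]
  [MeasurableSpace E] [BorelSpace E]

/-- The density of the standard Gaussian distribution in dimension `k`, as a function of the
norm. -/
def gaussDensity (k : ℕ) (r : ℝ) : ℝ := (2 * π) ^ (-(k : ℝ) / 2) * Real.exp (-r ^ 2 / 2)

lemma gaussDensity_nonneg (k : ℕ) (r : ℝ) : 0 ≤ gaussDensity k r := by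
  unfold gaussDensity; positivity

lemma continuous_gaussDensity (k : ℕ) : Continuous (gaussDensity k) := by
  unfold gaussDensity; fun_prop

lemma integrable_gaussDensity_norm :
    Integrable fun x : E => gaussDensity (finrank ℝ E) ‖x‖ := by
  have h := (GaussianFourier.integrable_cexp_neg_mul_sq_norm_add (V := E) (b := 1 / 2)
    (by norm_num) 0 0).norm
  simp only [gaussDensity]
  refine (h.const_mul ((2 * π) ^ (-(finrank ℝ E : ℝ) / 2))).congr (Filter.Eventually.of_forall fun x => ?_)
  simp only [Complex.norm_exp]
  congr 2
  simp [← Complex.ofReal_pow]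
  ring

lemma integral_gaussDensity_mul_cexp (t : E) :
    ∫ x : E, (gaussDensity (finrank ℝ E) ‖x‖ : ℂ) * cexp (inner ℝ x t * I) =
      cexp (-‖t‖ ^ 2 / 2) := by
  have h := GaussianFourier.integral_cexp_neg_mul_sq_norm_add (V := E) (b := 1 / 2)
    (by norm_num) I t
  have h1 : ∀ x : E, (gaussDensity (finrank ℝ E) ‖x‖ : ℂ) * cexp (inner ℝ x t * I) =
      (((2 * π) ^ (-(finrank ℝ E : ℝ) / 2) : ℝ) : ℂ) *
        cexp (-(1 / 2) * ‖x‖ ^ 2 + I * inner ℝ t x) := by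
    intro x
    rw [gaussDensity, Complex.ofReal_mul, mul_assoc, Complex.ofReal_exp, ← Complex.exp_add,
      real_inner_comm]
    congr 2
    push_cast
    ring
  simp_rw [h1]
  rw [integral_const_mul, h, ← mul_assoc]
  have h2 : (((2 * π) ^ (-(finrank ℝ E : ℝ) / 2) : ℝ) : ℂ) *
      ((π : ℂ) / (1 / 2)) ^ ((finrank ℝ E : ℂ) / 2) = 1 := by
    have : ((π : ℂ) / (1 / 2)) ^ ((finrank ℝ E : ℂ) / 2) =
        (((2 * π) ^ ((finrank ℝ E : ℝ) / 2) : ℝ) : ℂ) := by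
      rw [Complex.ofReal_cpow (by positivity)]
      push_cast
      congr 1
      ring
    rw [this, ← Complex.ofReal_mul, ← Real.rpow_add (by positivity)]
    simp [neg_div]
  rw [h2, one_mul]
  congr 1
  rw [Complex.I_sq]
  ring

/-- Both are finite measures with characteristic function `exp (-‖t‖ ^ 2 / 2)`. -/
lemma stdGaussian_eq_withDensity :
    stdGaussian E = volume.withDensity fun x =>
      ENNReal.ofReal (gaussDensity (finrank ℝ E) ‖x‖) := by
  have hc : Measurable fun x : E => (gaussDensity (finrank ℝ E) ‖x‖).toNNReal :=
    ((continuous_gaussDensity _).comp continuous_norm).measurable.real_toNNReal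
  have : IsFiniteMeasure (volume.withDensity fun x : E =>
      ENNReal.ofReal (gaussDensity (finrank ℝ E) ‖x‖)) :=
    isFiniteMeasure_withDensity_ofReal integrable_gaussDensity_norm.2
  refine Measure.ext_of_charFun (funext fun t => ?_)
  rw [charFun_stdGaussian, ← integral_gaussDensity_mul_cexp, charFun_apply]
  simp only [ENNReal.ofReal]
  rw [integral_withDensity_eq_integral_smul hc]
  refine integral_congr_ae (Filter.Eventually.of_forall fun x => ?_)
  simp only [NNReal.smul_def, Real.coe_toNNReal _ (gaussDensity_nonneg _ _), Complex.real_smul]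

/-- The density is radial, so polar coordinates give the density of the norm as `y ^ (k - 1)` times
the radial profile times the surface area of the unit sphere. -/
lemma map_norm_stdGaussian [Nontrivial E] :
    (stdGaussian E).map norm = chiMeasure (finrank ℝ E) := by
  set k := finrank ℝ E with hk
  have hkpos : 0 < k := finrank_pos
  set c : ℝ := 1 / ((2 : ℝ) ^ ((k : ℝ) / 2 - 1) * Real.Gamma ((k : ℝ) / 2)) with hc
  have hΓ : 0 < Real.Gamma ((k : ℝ) / 2) := Real.Gamma_pos_of_pos (by positivity)
  -- The sphere has area `k` times the volume of the ball, and `Γ(k/2 + 1) = (k/2) Γ(k/2)` absorbs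
  -- the factor `k`.
  have hconst : (k : ℝ) * volume.real (Metric.ball (0 : E) 1) * (2 * π) ^ (-(k : ℝ) / 2) = c := by
    have hv : volume.real (Metric.ball (0 : E) 1) = √π ^ k / Real.Gamma ((k : ℝ) / 2 + 1) := by
      rw [Measure.real, InnerProductSpace.volume_ball, ENNReal.ofReal_one, one_pow, one_mul,
        ENNReal.toReal_ofReal (by positivity)]
    have h2 : √π ^ k = π ^ ((k : ℝ) / 2) := by
      rw [Real.sqrt_eq_rpow, ← Real.rpow_natCast, ← Real.rpow_mul pi_pos.le]
      congr 1; ring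
    rw [hv, h2, Real.Gamma_add_one (by positivity), neg_div, Real.rpow_neg (by positivity),
      Real.mul_rpow (by positivity) pi_pos.le, hc, Real.rpow_sub_one (by positivity)]
    have := (Real.rpow_pos_of_pos pi_pos ((k : ℝ) / 2)).ne'
    field_simp
  ext A hA
  -- Polar integration of the profile cut off to `A` computes the mass of `A`.
  set g : ℝ → ℝ := A.indicator (gaussDensity k) with hg
  have hg0 : ∀ r, 0 ≤ g r := fun r => Set.indicator_nonneg (fun _ _ => gaussDensity_nonneg _ _) r
  have hgi : Integrable fun x : E => g ‖x‖ := by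
    have := (integrable_gaussDensity_norm (E := E)).indicator (measurable_norm hA)
    exact this
  have hgi' : IntegrableOn (fun y : ℝ => y ^ (k - 1) • g y) (Set.Ioi 0) :=
    (integrable_fun_norm_addHaar volume).1 hgi
  have key : ∫ x : E, g ‖x‖ = ∫ y in Set.Ioi (0 : ℝ),
      k * volume.real (Metric.ball (0 : E) 1) * (y ^ (k - 1) • g y) := by
    rw [integral_fun_norm_addHaar, integral_const_mul]
    simp [← hk, mul_assoc]
  have hlhs : (stdGaussian E).map norm A = ENNReal.ofReal (∫ x : E, g ‖x‖) := by
    rw [Measure.map_apply measurable_norm hA, stdGaussian_eq_withDensity,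
      withDensity_apply _ (measurable_norm hA), ofReal_integral_eq_lintegral_ofReal hgi
        (Filter.Eventually.of_forall fun x => hg0 _), ← lintegral_indicator (measurable_norm hA)]
    refine lintegral_congr fun x => ?_
    by_cases hx : ‖x‖ ∈ A <;> simp [hg, hx, ← hk]
  rw [hlhs, key, ofReal_integral_eq_lintegral_ofReal (hgi'.const_mul _), chiMeasure,
    withDensity_apply _ hA, ← lintegral_indicator hA, ← lintegral_indicator measurableSet_Ioi]
  · refine lintegral_congr fun y => ?_
    by_cases hy : 0 < y
    · by_cases hyA : y ∈ A
      · have : y ^ (k - 1) = y ^ ((k : ℝ) - 1) := by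
          rw [← Real.rpow_natCast, Nat.cast_sub hkpos, Nat.cast_one]
        simp only [Set.indicator, Set.mem_Ioi, hy, hyA, if_true, hg, smul_eq_mul, ← hc, this,
          gaussDensity]
        congr 1
        rw [← hconst]
        ring
      · simp [hyA, hg]
    · by_cases hyA : y ∈ A <;> simp [hy, hyA]
  · refine (ae_restrict_iff' measurableSet_Ioi).2 (Filter.Eventually.of_forall fun y hy => ?_)
    have : 0 < y := hy
    have := hg0 y
    simp only [Pi.zero_apply, smul_eq_mul]
    positivity

end Chi

/-! ### Rotation invariance of Gaussian matrices -/

section PiGaussian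

variable {ι : Type*} [Fintype ι] {E : Type*} [NormedAddCommGroup E] [InnerProductSpace ℝ E]
  [FiniteDimensional ℝ E] [MeasurableSpace E] [BorelSpace E] [SecondCountableTopology E]

lemma map_toLp_pi_stdGaussian :
    (Measure.pi fun _ : ι => stdGaussian E).map (WithLp.toLp 2) =
      stdGaussian (PiLp 2 fun _ : ι => E) := by
  refine Measure.ext_of_charFun (funext fun t => ?_)
  rw [charFun_pi, charFun_stdGaussian]
  simp_rw [charFun_stdGaussian]
  rw [← Complex.exp_sum, ← Complex.ofReal_pow, PiLp.norm_sq_eq_of_L2]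
  congr 1
  push_cast
  rw [← Finset.sum_div, Finset.sum_neg_distrib]

lemma stdGaussian_map_linearIsometry {F : Type*} [NormedAddCommGroup F] [InnerProductSpace ℝ F]
    [FiniteDimensional ℝ F] [MeasurableSpace F] [BorelSpace F] (T : E →ₗᵢ[ℝ] F)
    (h : Module.finrank ℝ E = Module.finrank ℝ F) :
    (stdGaussian E).map T = stdGaussian F := by
  rw [← stdGaussian_map (T.toLinearIsometryEquiv h), LinearIsometry.coe_toLinearIsometryEquiv]

/-- The distribution of an `m × n` matrix with independent standard Gaussian entries. -/
def gaussMat (E : Type*) [NormedAddCommGroup E] [InnerProductSpace ℝ E]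
    [FiniteDimensional ℝ E] [MeasurableSpace E] [BorelSpace E] (m n : ℕ) :
    Measure (Fin m → Fin n → E) :=
  Measure.pi fun _ => Measure.pi fun _ => stdGaussian E

instance (m n : ℕ) : IsProbabilityMeasure (gaussMat E m n) := by
  unfold gaussMat; infer_instance

/-- The space of matrices with the Hilbert–Schmidt norm. -/
def matToLp (E : Type*) [NormedAddCommGroup E] [InnerProductSpace ℝ E] (m n : ℕ) :
    (Fin m → Fin n → E) ≃ₗ[ℝ] PiLp 2 fun _ : Fin m => PiLp 2 fun _ : Fin n => E where
  toFun X := WithLp.toLp 2 fun i => WithLp.toLp 2 (X i)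
  invFun p i j := p i j
  map_add' _ _ := rfl
  map_smul' _ _ := rfl
  left_inv _ := rfl
  right_inv _ := rfl

lemma measurable_matToLp (m n : ℕ) : Measurable (matToLp E m n) := by
  change Measurable fun X : Fin m → Fin n → E => WithLp.toLp 2 fun i => WithLp.toLp 2 (X i)
  fun_prop

lemma measurable_matToLp_symm (m n : ℕ) : Measurable (matToLp E m n).symm := by
  change Measurable fun (p : PiLp 2 fun _ : Fin m => PiLp 2 fun _ : Fin n => E) i j => p i j
  fun_prop

lemma norm_matToLp_sq {m n : ℕ} (X : Fin m → Fin n → E) :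
    ‖matToLp E m n X‖ ^ 2 = ∑ i, ∑ j, ‖X i j‖ ^ 2 := by
  rw [PiLp.norm_sq_eq_of_L2]
  refine Finset.sum_congr rfl fun i _ => ?_
  rw [PiLp.norm_sq_eq_of_L2]
  rfl

lemma map_matToLp_gaussMat (m n : ℕ) :
    (gaussMat E m n).map (matToLp E m n) =
      stdGaussian (PiLp 2 fun _ : Fin m => PiLp 2 fun _ : Fin n => E) := by
  rw [← map_toLp_pi_stdGaussian, ← map_toLp_pi_stdGaussian, ← Measure.pi_map_pi (by fun_prop),
    Measure.map_map (by fun_prop) (by fun_prop)]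
  rfl

lemma map_matToLp_symm_stdGaussian (m n : ℕ) :
    (stdGaussian (PiLp 2 fun _ : Fin m => PiLp 2 fun _ : Fin n => E)).map (matToLp E m n).symm =
      gaussMat E m n := by
  rw [← map_matToLp_gaussMat, Measure.map_map (measurable_matToLp_symm m n)
    (measurable_matToLp m n)]
  convert Measure.map_id
  ext X
  simp

/-- For the Hilbert–Schmidt norm such a map is a linear isometry between spaces of equal dimension,
and these preserve the standard Gaussian law. The shapes may differ so that transposition is
covered. -/
lemma gaussMat_map {m n m' n' : ℕ} (h : m * n = m' * n')
    (T : (Fin m → Fin n → E) →ₗ[ℝ] (Fin m' → Fin n' → E))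
    (hT : ∀ X, ∑ i, ∑ j, ‖T X i j‖ ^ 2 = ∑ i, ∑ j, ‖X i j‖ ^ 2) :
    (gaussMat E m n).map T = gaussMat E m' n' := by
  let T' : (PiLp 2 fun _ : Fin m => PiLp 2 fun _ : Fin n => E) →ₗᵢ[ℝ]
      (PiLp 2 fun _ : Fin m' => PiLp 2 fun _ : Fin n' => E) :=
    { toLinearMap := (matToLp E m' n').toLinearMap ∘ₗ T ∘ₗ (matToLp E m n).symm.toLinearMap
      norm_map' := by
        intro p
        obtain ⟨X, rfl⟩ := (matToLp E m n).surjective p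
        rw [← sq_eq_sq₀ (norm_nonneg _) (norm_nonneg _), norm_matToLp_sq, ← hT, ← norm_matToLp_sq]
        simp }
  have hrank : Module.finrank ℝ (PiLp 2 fun _ : Fin m => PiLp 2 fun _ : Fin n => E) =
      Module.finrank ℝ (PiLp 2 fun _ : Fin m' => PiLp 2 fun _ : Fin n' => E) := by
    rw [← (matToLp E m n).finrank_eq, ← (matToLp E m' n').finrank_eq]
    simp [Module.finrank_pi_fintype, ← mul_assoc, h]
  have hTmeas : Measurable T := (LinearMap.continuous_of_finiteDimensional T).measurable
  rw [← map_matToLp_symm_stdGaussian m' n', ← stdGaussian_map_linearIsometry T' hrank,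
    ← map_matToLp_gaussMat, Measure.map_map T'.continuous.measurable (measurable_matToLp m n),
    Measure.map_map (measurable_matToLp_symm _ _)
      (T'.continuous.measurable.comp (measurable_matToLp m n))]
  congr 1

end PiGaussian

end

/-! ### Measurability and the joint law of the off-diagonal entries -/

namespace NormStar

noncomputable section

variable {K : Type*} [NormedDivisionRing K] [StarRing K] [InnerProductSpace ℝ K]
  [IsScalarTower ℝ K K] [SMulCommClass ℝ K K] [StarModule ℝ K] [NormStar K]
variable [FiniteDimensional ℝ K] [MeasurableSpace K] [BorelSpace K] [SecondCountableTopology K]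

lemma continuous_star' : Continuous (star : K → K) :=
  LinearMap.continuous_of_finiteDimensional
    ({ toFun := star, map_add' := star_add, map_smul' := by simp } : K →ₗ[ℝ] K)

lemma measurable_star' : Measurable (star : K → K) := (continuous_star' (K := K)).measurable

lemma measurable_phase : Measurable (phase : K → K) := by
  classical
  unfold phase
  exact Measurable.ite (measurableSet_singleton 0) measurable_const
    (measurable_norm.inv.smul measurable_id)

lemma measurable_sqSum {ι : Type*} [Fintype ι] : Measurable (sqSum : (ι → K) → ℝ) := by
  unfold sqSum; fun_prop

lemma measurable_reflection {α : Type*} [MeasurableSpace α] {n : ℕ} {w : α → Fin n → K}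
    (hw : Measurable w) (i j : Fin n) : Measurable fun a => reflection (w a) i j := by
  have hi : ∀ i, Measurable fun a => w a i := fun i => (measurable_pi_apply i).comp hw
  simp only [reflection, Matrix.sub_apply, Matrix.smul_apply, vecMulVec_apply, Pi.star_apply]
  exact measurable_const.sub (((measurable_sqSum.comp hw).const_div 2).smul
    ((hi i).mul (measurable_star'.comp (hi j))))

lemma measurable_householder {n : ℕ} (i j : Fin n) :
    Measurable fun v : Fin n → K => householder v i j := by
  cases n with
  | zero => exact i.elim0
  | succ n =>
    have hph : Measurable fun v : Fin (n + 1) → K => phase (v 0) :=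
      measurable_phase.comp (measurable_pi_apply 0)
    have hsq : Measurable fun v : Fin (n + 1) → K => √(sqSum v) := measurable_sqSum.sqrt
    have hw : Measurable fun v : Fin (n + 1) → K =>
        v + Pi.single 0 (√(sqSum v) • phase (v 0)) := by
      refine measurable_pi_iff.2 fun i => ?_
      refine Fin.cases ?_ (fun i => ?_) i
      · simp only [Pi.add_apply, Pi.single_eq_same]
        exact (measurable_pi_apply 0).add (hsq.smul hph)
      · simpa using measurable_pi_apply i.succ
    simp only [householder, diagonal_mul]
    refine Measurable.mul ?_ (measurable_reflection hw i j)
    refine Fin.cases ?_ (fun i => ?_) i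
    · exact (measurable_star'.comp hph).neg
    · simp

lemma measurable_matrix_mul {α : Type*} [MeasurableSpace α] {l m n : ℕ}
    {A : α → Matrix (Fin l) (Fin m) K} {B : α → Matrix (Fin m) (Fin n) K}
    (hA : ∀ i j, Measurable fun a => A a i j) (hB : ∀ i j, Measurable fun a => B a i j) :
    Measurable fun a => Matrix.of.symm (A a * B a) := by
  refine measurable_pi_iff.2 fun i => measurable_pi_iff.2 fun j => ?_
  simp only [Matrix.of_symm_apply, Matrix.mul_apply]
  exact Finset.measurable_sum _ fun k _ => (hA i k).mul (hB k j)

lemma measurable_householder_mul_conjTranspose {m n : ℕ} :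
    Measurable fun p : (Fin n → K) × (Fin m → Fin n → K) =>
      Matrix.of.symm (householder (star p.1) * (Matrix.of p.2)ᴴ) := by
  refine measurable_matrix_mul (fun i j => ?_) fun i j => ?_
  · refine (measurable_householder i j).comp (measurable_pi_iff.2 fun k => ?_)
    exact measurable_star'.comp ((measurable_pi_apply k).comp measurable_fst)
  · exact measurable_star'.comp (by fun_prop : Measurable
      fun p : (Fin n → K) × (Fin m → Fin n → K) => p.2 j i)

lemma measurable_bidiag (k : ℕ) : ∀ m n : ℕ,
    Measurable (bidiag k m n : (Fin m → Fin n → K) → ℝ) := by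
  induction k with
  | zero =>
    intro m n
    cases m with
    | zero => exact measurable_const
    | succ m =>
      exact (measurable_sqSum.comp (measurable_pi_apply (0 : Fin (m + 1)))).sqrt
  | succ k ih =>
    intro m n
    cases m with
    | zero => exact measurable_const
    | succ m =>
      have h : Measurable fun X : Fin (m + 1) → Fin n → K => (X 0, fun i : Fin m => X i.succ) := by
        fun_prop
      have := (ih n m).comp (measurable_householder_mul_conjTranspose.comp h)
      exact this

lemma sqSum_mulVec {n : ℕ} {V : Matrix (Fin n) (Fin n) K} (hV : Vᴴ * V = 1) (v : Fin n → K) :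
    sqSum (V *ᵥ v) = sqSum v := by
  refine smul_one_injective (K := K) ?_
  rw [← star_dotProduct_self, ← star_dotProduct_self, star_mulVec, ← dotProduct_mulVec,
    mulVec_mulVec, hV, one_mulVec]

lemma sum_norm_sq_mul {m n : ℕ} {V : Matrix (Fin n) (Fin n) K} (hV : Vᴴ * V = 1)
    (A : Matrix (Fin n) (Fin m) K) :
    ∑ i, ∑ j, ‖(V * A) i j‖ ^ 2 = ∑ i, ∑ j, ‖A i j‖ ^ 2 := by
  rw [Finset.sum_comm, Finset.sum_comm (f := fun i j => ‖A i j‖ ^ 2)]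
  exact Finset.sum_congr rfl fun j _ => sqSum_mulVec hV fun i => A i j

/-- Conjugate transposition is real-linear and norm preserving, which is all that `gaussMat_map`
asks for. -/
lemma gaussMat_map_mul_conjTranspose (m n : ℕ) {V : Matrix (Fin n) (Fin n) K} (hV : Vᴴ * V = 1) :
    (gaussMat K m n).map (fun R => Matrix.of.symm (V * (Matrix.of R)ᴴ)) =
      gaussMat K n m := by
  let T : (Fin m → Fin n → K) →ₗ[ℝ] (Fin n → Fin m → K) :=
    { toFun := fun R => Matrix.of.symm (V * (Matrix.of R)ᴴ)
      map_add' := fun A B => by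
        change V * (Matrix.of A + Matrix.of B)ᴴ = V * (Matrix.of A)ᴴ + V * (Matrix.of B)ᴴ
        rw [conjTranspose_add, Matrix.mul_add]
      map_smul' := fun r A => by
        change V * (r • Matrix.of A)ᴴ = r • (V * (Matrix.of A)ᴴ)
        rw [conjTranspose_smul, star_trivial, Matrix.mul_smul] }
  refine gaussMat_map (mul_comm m n) T fun R => ?_
  refine (sum_norm_sq_mul hV _).trans ?_
  rw [Finset.sum_comm]
  simp [norm_star']

lemma gaussMat_map_mul (m n : ℕ) {V : Matrix (Fin m) (Fin m) K} (hV : Vᴴ * V = 1) :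
    (gaussMat K m n).map (fun R => Matrix.of.symm (V * Matrix.of R)) = gaussMat K m n := by
  let T : (Fin m → Fin n → K) →ₗ[ℝ] (Fin m → Fin n → K) :=
    { toFun := fun R => Matrix.of.symm (V * Matrix.of R)
      map_add' := fun A B => Matrix.mul_add V (Matrix.of A) (Matrix.of B)
      map_smul' := fun r A => Matrix.mul_smul V r (Matrix.of A) }
  exact gaussMat_map rfl T fun R => sum_norm_sq_mul hV _

/-- The distribution of the norm of a standard Gaussian vector in dimension `k`. -/
def normLaw (k : ℕ) : Measure ℝ := (stdGaussian (EuclideanSpace ℝ (Fin k))).map norm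

instance (k : ℕ) : IsProbabilityMeasure (normLaw k) :=
  Measure.isProbabilityMeasure_map measurable_norm.aemeasurable

/-- In dimension zero `normLaw` is the point mass at `0`, which has no density; hence the positivity
assumption. -/
lemma normLaw_eq_chiMeasure {k : ℕ} (hk : 0 < k) : normLaw k = chiMeasure k := by
  have : Nonempty (Fin k) := ⟨⟨0, hk⟩⟩
  rw [normLaw, map_norm_stdGaussian, finrank_euclideanSpace_fin]

lemma map_sqrt_sqSum (n : ℕ) :
    (Measure.pi fun _ : Fin n => stdGaussian K).map (fun r => √(sqSum r)) =
      normLaw (Module.finrank ℝ K * n) := by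
  have h1 : (fun r : Fin n → K => √(sqSum r)) = norm ∘ WithLp.toLp 2 := by
    ext r
    rw [Function.comp_apply, PiLp.norm_eq_of_L2]
    rfl
  have hrank : Module.finrank ℝ (PiLp 2 fun _ : Fin n => K) = Module.finrank ℝ K * n := by
    rw [(WithLp.linearEquiv 2 ℝ (Fin n → K)).finrank_eq]
    simp [Module.finrank_pi_fintype, mul_comm]
  let e := ((stdOrthonormalBasis ℝ (PiLp 2 fun _ : Fin n => K)).reindex (finCongr hrank)).repr
  rw [h1, ← Measure.map_map measurable_norm (by fun_prop), map_toLp_pi_stdGaussian, normLaw,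
    ← stdGaussian_map e, Measure.map_map measurable_norm e.continuous.measurable]
  congr 1
  ext p
  simp

/-- The distributions of the entries `bidiag` of a Gaussian matrix with `d`-dimensional entries. -/
def bidiagLaw (d : ℕ) : ℕ → ℕ → ℕ → Measure ℝ
  | _, 0, _ => Measure.dirac 0
  | 0, _ + 1, n => normLaw (d * n)
  | k + 1, m + 1, n => bidiagLaw d k n m

instance (d k m n : ℕ) : IsProbabilityMeasure (bidiagLaw d k m n) := by
  induction k generalizing m n with
  | zero => cases m <;> (unfold bidiagLaw; infer_instance)
  | succ k ih =>
    cases m with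
    | zero => unfold bidiagLaw; infer_instance
    | succ m => unfold bidiagLaw; exact ih n m

lemma pi_dirac {ι : Type*} [Fintype ι] (a : ι → ℝ) :
    (Measure.pi fun i => Measure.dirac (a i)) = Measure.dirac a := by
  refine Measure.pi_eq fun s hs => ?_
  rw [Measure.dirac_apply' _ (MeasurableSet.univ_pi hs)]
  simp_rw [Measure.dirac_apply' _ (hs _)]
  by_cases h : ∀ i, a i ∈ s i
  · simp [Set.indicator, h]
  · obtain ⟨i, hi⟩ := not_forall.1 h
    rw [Finset.prod_eq_zero (Finset.mem_univ i) (by simp [hi])]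
    simp [Set.indicator, h]

/-- Given the first row, the rotation it determines preserves the law of the other rows. The rotated
remainder is thus a Gaussian matrix independent of that row, and the induction continues with `m`
and `n` exchanged. `N` is arbitrary; entries beyond the extent of the matrix are deterministically
zero. -/
theorem map_bidiag (N : ℕ) : ∀ m n : ℕ,
    (gaussMat K m n).map (fun X (k : Fin N) => bidiag k m n X) =
      Measure.pi fun k : Fin N => bidiagLaw (Module.finrank ℝ K) k m n := by
  induction N with
  | zero =>
    intro m n
    rw [Measure.pi_of_empty _ (fun i => i.elim0)]
    have : (fun (X : Fin m → Fin n → K) (k : Fin 0) => bidiag k m n X) =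
        fun _ => fun i => i.elim0 := by
      ext X i
      exact i.elim0
    rw [this, Measure.map_const, measure_univ, one_smul]
  | succ N ih =>
    intro m n
    cases m with
    | zero =>
      have h1 : (fun (X : Fin 0 → Fin n → K) (k : Fin (N + 1)) => bidiag k 0 n X) = fun _ => 0 := by
        ext X k
        simp [bidiag]
      rw [h1, Measure.map_const, measure_univ, one_smul]
      simp only [bidiagLaw]
      exact (pi_dirac _).symm
    | succ m =>
      have p0 := measurePreserving_piFinSuccAbove
        (fun _ : Fin (m + 1) => Measure.pi fun _ : Fin n => stdGaussian K) 0
      -- A fibrewise measure-preserving map is measure preserving on the product; this is where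
      -- independence of the row and the rotated remainder comes from.
      have p1 : MeasurePreserving
          (fun p : (Fin n → K) × (Fin m → Fin n → K) =>
            (p.1, Matrix.of.symm (householder (star p.1) * (Matrix.of p.2)ᴴ)))
          ((Measure.pi fun _ : Fin n => stdGaussian K).prod (gaussMat K m n))
          ((Measure.pi fun _ : Fin n => stdGaussian K).prod (gaussMat K n m)) :=
        (MeasurePreserving.id _).skew_product
          (g := fun r R => Matrix.of.symm (householder (star r) * (Matrix.of R)ᴴ))
          measurable_householder_mul_conjTranspose
          (Filter.Eventually.of_forall fun r =>
            gaussMat_map_mul_conjTranspose m n (conjTranspose_mul_householder _))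
      have p2 : MeasurePreserving
          (Prod.map (fun r : Fin n → K => √(sqSum r))
            (fun (X : Fin n → Fin m → K) (k : Fin N) => bidiag k n m X))
          ((Measure.pi fun _ : Fin n => stdGaussian K).prod (gaussMat K n m))
          ((normLaw (Module.finrank ℝ K * n)).prod
            (Measure.pi fun k : Fin N => bidiagLaw (Module.finrank ℝ K) k n m)) :=
        MeasurePreserving.prod ⟨measurable_sqSum.sqrt, map_sqrt_sqSum n⟩
          ⟨measurable_pi_iff.2 fun k => measurable_bidiag k n m, ih n m⟩
      have p3 := (measurePreserving_piFinSuccAbove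
        (fun k : Fin (N + 1) => bidiagLaw (Module.finrank ℝ K) k (m + 1) n) 0).symm
      have p4 := p3.comp (p2.comp (p1.comp p0))
      rw [← p4.map_eq]
      congr 1
      ext X k
      refine Fin.cases ?_ (fun k => ?_) k <;> rfl

/-- Two steps remove one row and one column, so the index drops by two while `m` and `n` drop by one
each. -/
lemma bidiagLaw_even (d j : ℕ) : ∀ {m n : ℕ}, j < min m n →
    bidiagLaw d (2 * j) m n = normLaw (d * (n - j)) := by
  induction j with
  | zero =>
    rintro (_ | m) n h
    · simp at h
    · rfl
  | succ j ih =>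
    rintro (_ | m) (_ | n) h
    · simp at h
    · simp at h
    · simp at h
    · rw [show n + 1 - (j + 1) = n - j by omega, ← ih (m := m) (n := n) (by omega)]
      rfl

lemma bidiagLaw_odd (d j : ℕ) : ∀ {m n : ℕ}, j < min (m - 1) n →
    bidiagLaw d (2 * j + 1) m n = normLaw (d * (m - 1 - j)) := by
  induction j with
  | zero =>
    rintro (_ | m) (_ | n) h
    · simp at h
    · simp at h
    · simp at h
    · rfl
  | succ j ih =>
    rintro (_ | m) (_ | n) h
    · simp at h
    · simp at h
    · simp at h
    · rw [show m + 1 - 1 - (j + 1) = m - 1 - j by omega, ← ih (m := m) (n := n) (by omega)]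
      rfl

/-- Once one dimension is used up, the next row is empty or absent. This matches the zero padding in
`offDiag`. -/
lemma bidiag_even_eq_zero (j : ℕ) : ∀ {m n : ℕ}, min m n ≤ j → ∀ X : Fin m → Fin n → K,
    bidiag (2 * j) m n X = 0 := by
  induction j with
  | zero =>
    rintro (_ | m) (_ | n) h X
    · rfl
    · rfl
    · simp [bidiag, sqSum]
    · simp at h
  | succ j ih =>
    rintro (_ | m) (_ | n) h X
    · rfl
    · rfl
    · rfl
    · exact ih (by omega) _

lemma bidiag_odd_eq_zero (j : ℕ) : ∀ {m n : ℕ}, min (m - 1) n ≤ j → ∀ X : Fin m → Fin n → K,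
    bidiag (2 * j + 1) m n X = 0 := by
  induction j with
  | zero =>
    rintro (_ | m) (_ | n) h X
    · rfl
    · rfl
    · rfl
    · obtain rfl : m = 0 := by omega
      simp [bidiag, sqSum]
  | succ j ih =>
    rintro (_ | m) (_ | n) h X
    · rfl
    · rfl
    · rfl
    · exact ih (by omega) _

lemma offDiag_bidiag {m n : ℕ} (X : Fin m → Fin n → K) :
    offDiag (fun j : Fin (min m n) => bidiag (2 * (j : ℕ)) m n X)
      (fun j : Fin (min (m - 1) n) => bidiag (2 * (j : ℕ) + 1) m n X) =
    fun k => bidiag k m n X := by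
  ext k
  unfold offDiag
  split_ifs with h h1 h2
  · exact congrArg (fun q => bidiag q m n X) (by simp only; omega)
  · rw [← bidiag_even_eq_zero (k / 2) (not_lt.1 h1) X]
    exact congrArg (fun q => bidiag q m n X) (by omega)
  · exact congrArg (fun q => bidiag q m n X) (by simp only; omega)
  · rw [← bidiag_odd_eq_zero (k / 2) (not_lt.1 h2) X]
    exact congrArg (fun q => bidiag q m n X) (by omega)

/-- Multiply a matrix by the unitary matrix that reduces the pivot column of `B`. -/
def pivotReduce {m n : ℕ} (B : Fin m → Fin m → K) (R : Fin m → Fin n → K) : Fin m → Fin n → K :=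
  Matrix.of.symm (householder (pivotCol B) * Matrix.of R)

lemma measurable_pivotCol {m : ℕ} : Measurable (pivotCol : (Fin m → Fin m → K) → Fin m → K) := by
  classical
  refine measurable_pi_iff.2 fun j => ?_
  simp only [pivotCol]
  have hs : ∀ i : Fin m, MeasurableSet {B : Fin m → Fin m → K | B i i = 0} := fun i =>
    (by fun_prop : Measurable fun B : Fin m → Fin m → K => B i i) (measurableSet_singleton 0)
  refine Finset.measurable_sum _ fun k _ => Measurable.ite ?_ (by fun_prop) measurable_const
  refine (hs k).compl.inter ?_
  have : {B : Fin m → Fin m → K | ∀ i < k, B i i = 0} = ⋂ i, ⋂ (_ : i < k), {B | B i i = 0} := by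
    ext B
    simp
  change MeasurableSet {B : Fin m → Fin m → K | ∀ i < k, B i i = 0}
  rw [this]
  exact MeasurableSet.iInter fun i => MeasurableSet.iInter fun _ => hs i

/-! ### Independence from the perturbation -/

section Main

variable {Ω T : Type*} [MeasurableSpace Ω] [MeasurableSpace T] {μ : Measure Ω}
  [IsProbabilityMeasure μ]

/-- By independence the law of `(G, X)` is a product, and `(t, s) ↦ (t, F t s)` preserves it. So the
pair `(G, F G X)` has the same product law. -/
lemma _root_.ProbabilityTheory.IndepFun.fiberwise_measurePreserving {S : Type*} [MeasurableSpace S]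
    {X : Ω → S} {G : Ω → T}
    (hX : Measurable X) (hG : Measurable G) (h : IndepFun X G μ) {F : T → S → S}
    (hF : Measurable (Function.uncurry F)) (hmap : ∀ t, (μ.map X).map (F t) = μ.map X) :
    Measurable (fun ω => F (G ω) (X ω)) ∧ μ.map (fun ω => F (G ω) (X ω)) = μ.map X ∧
      IndepFun (fun ω => F (G ω) (X ω)) G μ := by
  have := Measure.isProbabilityMeasure_map (μ := μ) hX.aemeasurable
  have := Measure.isProbabilityMeasure_map (μ := μ) hG.aemeasurable
  have hFm : Measurable fun ω => F (G ω) (X ω) := hF.comp (hG.prodMk hX)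
  have hp := (MeasurePreserving.id (μ.map G)).skew_product hF (μc := μ.map X) (μd := μ.map X)
    (Filter.Eventually.of_forall hmap)
  have hj : μ.map (fun ω => (G ω, F (G ω) (X ω))) = (μ.map G).prod (μ.map X) := by
    rw [← hp.map_eq, ← (indepFun_iff_map_prod_eq_prod_map_map hG.aemeasurable
      hX.aemeasurable).1 h.symm, Measure.map_map hp.measurable (hG.prodMk hX)]
    rfl
  have hlaw : μ.map (fun ω => F (G ω) (X ω)) = μ.map X := by
    have := congrArg (Measure.map Prod.snd) hj
    rw [Measure.map_map measurable_snd (hG.prodMk hFm), Measure.map_snd_prod, measure_univ,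
      one_smul] at this
    exact this
  refine ⟨hFm, hlaw, IndepFun.symm ?_⟩
  rw [indepFun_iff_map_prod_eq_prod_map_map hG.aemeasurable hFm.aemeasurable, hj, hlaw]

theorem isChiFamily_bidiag {m n : ℕ} {X : Ω → Fin m → Fin n → K} (hX : Measurable X)
    (hlaw : μ.map X = gaussMat K m n) :
    IsChiFamily (Module.finrank ℝ K)
      (fun (j : Fin (min m n)) ω => bidiag (2 * (j : ℕ)) m n (X ω))
      (fun (j : Fin (min (m - 1) n)) ω => bidiag (2 * (j : ℕ) + 1) m n (X ω)) μ := by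
  have hd : 0 < Module.finrank ℝ K := Module.finrank_pos
  have hmeas : ∀ k, Measurable fun ω => bidiag k m n (X ω) := fun k =>
    (measurable_bidiag k m n).comp hX
  have hN : ∀ N, μ.map (fun ω (k : Fin N) => bidiag k m n (X ω)) =
      Measure.pi fun k : Fin N => bidiagLaw (Module.finrank ℝ K) k m n := by
    intro N
    rw [← map_bidiag, ← hlaw, Measure.map_map
      (measurable_pi_iff.2 fun k : Fin N => measurable_bidiag (k : ℕ) m n) hX]
    rfl
  have hk : ∀ k, μ.map (fun ω => bidiag k m n (X ω)) =
      bidiagLaw (Module.finrank ℝ K) k m n := by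
    intro k
    have := congrArg (Measure.map (Function.eval (Fin.last k))) (hN (k + 1))
    rw [Measure.map_map (measurable_pi_apply _) (measurable_pi_iff.2 fun i : Fin (k + 1) => hmeas i),
      (measurePreserving_eval _ _).map_eq] at this
    exact this
  refine ⟨fun j => hmeas _, fun j => hmeas _, fun j => ⟨(hmeas _).aemeasurable, ?_⟩,
    fun j => ⟨(hmeas _).aemeasurable, ?_⟩, ?_⟩
  · have hj := j.2
    rw [hk, bidiagLaw_even _ _ j.2, normLaw_eq_chiMeasure (Nat.mul_pos hd (by omega)),
      Nat.cast_mul, Nat.cast_sub (by omega)]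
  · have hj := j.2
    rw [hk, bidiagLaw_odd _ _ j.2, normLaw_eq_chiMeasure (Nat.mul_pos hd (by omega)),
      Nat.cast_mul, Nat.cast_sub (by omega), Nat.cast_sub (by omega), Nat.cast_one]
  -- Positions `2 * j` and `2 * j + 1` with `j < n` lie below `2 * n + 2`, so both families are
  -- picked out of one independent sequence by an injection `g`.
  · have hind : iIndepFun (fun (k : Fin (2 * n + 2)) ω => bidiag k m n (X ω)) μ := by
      rw [iIndepFun_iff_map_fun_eq_pi_map fun k : Fin (2 * n + 2) => (hmeas k).aemeasurable, hN]
      simp_rw [hk]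
    let g : Fin (min m n) ⊕ Fin (min (m - 1) n) → Fin (2 * n + 2) :=
      Sum.elim (fun j => ⟨2 * j, by omega⟩) (fun j => ⟨2 * j + 1, by omega⟩)
    have hg : Function.Injective g := by
      rintro (a | a) (b | b) h <;> simp [g, Fin.ext_iff] at h ⊢ <;> omega
    convert hind.precomp hg with i
    rcases i with i | i <;> rfl

lemma measurable_pivotReduce {m n : ℕ} {B : T → Fin m → Fin m → K} (hB : Measurable B) :
    Measurable (Function.uncurry fun (t : T) (R : Fin m → Fin n → K) => pivotReduce (B t) R) := by
  have h : Measurable fun p : T × (Fin m → Fin n → K) => pivotCol (B p.1) :=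
    measurable_pivotCol.comp (hB.comp measurable_fst)
  refine measurable_matrix_mul (A := fun p : T × (Fin m → Fin n → K) =>
    householder (pivotCol (B p.1))) (B := fun p => Matrix.of p.2) (fun i j => ?_) fun i j => ?_
  · exact (measurable_householder i j).comp h
  · exact (by fun_prop : Measurable fun p : T × (Fin m → Fin n → K) => p.2 i j)

lemma gaussMat_map_pivotReduce {m n : ℕ} (B : Fin m → Fin m → K) :
    (gaussMat K m n).map (pivotReduce B) = gaussMat K m n :=
  gaussMat_map_mul m n (conjTranspose_mul_householder _)

/-- The variables are the entries `bidiag` of the pivot-reduced matrix. The reducing unitary is a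
measurable function of `G`, so this matrix is again Gaussian and independent of `G`. -/
theorem exists_chiFamily {m n : ℕ} {X : Ω → Fin m → Fin n → K} {G : Ω → T}
    {B : T → Fin m → Fin m → K} {l : Ω → ℝ} (hX : Measurable X)
    (hlaw : μ.map X = gaussMat K m n) (hG : Measurable G) (hXG : IndepFun X G μ)
    (hBm : Measurable B) (hB : ∀ᵐ ω ∂μ, IsRankOne (of (B (G ω))) (l ω)) :
    ∃ (x : Fin (min m n) → Ω → ℝ) (y : Fin (min (m - 1) n) → Ω → ℝ),
      IsChiFamily (Module.finrank ℝ K) x y μ ∧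
      IndepFun (fun ω => (fun j => x j ω, fun j => y j ω)) G μ ∧
      ∀ᵐ ω ∂μ, ∃ U ∈ unitary (Matrix (Fin (m + n)) (Fin (m + n)) K),
        U * reindex finSumFinEquiv finSumFinEquiv (chiralBlock (of (X ω))) * Uᴴ =
          triJ (m + n) (offDiag (fun j => x j ω) (fun j => y j ω)) ∧
        U * reindex finSumFinEquiv finSumFinEquiv (fromBlocks (of (B (G ω))) 0 0 0) * Uᴴ =
          corner (m + n) (l ω) := by
  obtain ⟨hm, h1, h2⟩ := hXG.fiberwise_measurePreserving hX hG (measurable_pivotReduce hBm)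
    fun t => by rw [hlaw, gaussMat_map_pivotReduce]
  have h3 := isChiFamily_bidiag hm (h1.trans hlaw)
  have hφ : Measurable fun R : Fin m → Fin n → K =>
      (fun j : Fin (min m n) => bidiag (2 * (j : ℕ)) m n R,
        fun j : Fin (min (m - 1) n) => bidiag (2 * (j : ℕ) + 1) m n R) :=
    (measurable_pi_iff.2 fun j : Fin (min m n) => measurable_bidiag (2 * (j : ℕ)) m n).prodMk
      (measurable_pi_iff.2 fun j : Fin (min (m - 1) n) => measurable_bidiag (2 * (j : ℕ) + 1) m n)
  refine ⟨_, _, h3, h2.comp hφ measurable_id, ?_⟩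
  filter_upwards [hB] with ω hω
  rw [offDiag_bidiag]
  exact exists_unitary_tridiagonal_corner (X ω) hω

end Main

/-! ### From real coordinates to Gaussian matrices -/

section Coordinates

variable {Ω T : Type*} [MeasurableSpace Ω] [MeasurableSpace T] {μ : Measure Ω}
  [IsProbabilityMeasure μ]

/-- The matrix with given real coordinates of the entries. -/
def ofCoords {d : ℕ} (e : K ≃ₗᵢ[ℝ] EuclideanSpace ℝ (Fin d)) (m n : ℕ)
    (f : Fin m × Fin n × Fin d → ℝ) : Fin m → Fin n → K :=
  fun i j => e.symm (WithLp.toLp 2 fun t => f (i, j, t))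

lemma measurable_ofCoords {d : ℕ} (e : K ≃ₗᵢ[ℝ] EuclideanSpace ℝ (Fin d)) (m n : ℕ) :
    Measurable (ofCoords e m n) := by
  refine measurable_pi_iff.2 fun i => measurable_pi_iff.2 fun j => ?_
  exact e.symm.continuous.measurable.comp (by fun_prop : Measurable
    fun f : Fin m × Fin n × Fin d → ℝ => WithLp.toLp 2 fun t => f (i, j, t))

/-- Assembling the entries from orthonormal coordinates is a linear isometry onto the
Hilbert–Schmidt space. -/
lemma map_ofCoords {d : ℕ} (e : K ≃ₗᵢ[ℝ] EuclideanSpace ℝ (Fin d)) (m n : ℕ) :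
    (Measure.pi fun _ : Fin m × Fin n × Fin d => gaussianReal 0 1).map (ofCoords e m n) =
      gaussMat K m n := by
  let L : EuclideanSpace ℝ (Fin m × Fin n × Fin d) →ₗᵢ[ℝ]
      (PiLp 2 fun _ : Fin m => PiLp 2 fun _ : Fin n => K) :=
    { toFun := fun f => matToLp K m n (ofCoords e m n f.ofLp)
      map_add' := fun f g => by
        rw [← map_add]
        congr 1
        ext i j
        exact map_add e.symm (WithLp.toLp 2 fun t => f (i, j, t)) (WithLp.toLp 2 fun t => g (i, j, t))
      map_smul' := fun r f => by
        rw [RingHom.id_apply, ← map_smul]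
        congr 1
        ext i j
        exact map_smul e.symm r (WithLp.toLp 2 fun t => f (i, j, t))
      norm_map' := fun f => by
        rw [← sq_eq_sq₀ (norm_nonneg _) (norm_nonneg _), LinearMap.coe_mk, AddHom.coe_mk,
          norm_matToLp_sq, EuclideanSpace.norm_sq_eq, Fintype.sum_prod_type]
        refine Finset.sum_congr rfl fun i _ => ?_
        rw [Fintype.sum_prod_type]
        refine Finset.sum_congr rfl fun j _ => ?_
        rw [ofCoords, e.symm.norm_map, EuclideanSpace.norm_sq_eq] }
  have hrank : Module.finrank ℝ (EuclideanSpace ℝ (Fin m × Fin n × Fin d)) =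
      Module.finrank ℝ (PiLp 2 fun _ : Fin m => PiLp 2 fun _ : Fin n => K) := by
    rw [← (matToLp K m n).finrank_eq]
    simp [Module.finrank_pi_fintype, e.toLinearEquiv.finrank_eq]
  rw [← map_matToLp_symm_stdGaussian, ← stdGaussian_map_linearIsometry L hrank,
    ← map_pi_eq_stdGaussian, Measure.map_map L.continuous.measurable (by fun_prop),
    Measure.map_map (measurable_matToLp_symm m n) (L.continuous.measurable.comp (by fun_prop))]
  congr 1

theorem exists_chiFamily_of_isGaussianMatrix {m n d : ℕ} {coord : Fin d → K → ℝ}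
    (e : K ≃ₗᵢ[ℝ] EuclideanSpace ℝ (Fin d)) (he : ∀ t a, coord t a = e a t)
    {X : Ω → Matrix (Fin m) (Fin n) K} {G : Ω → T} {B : T → Fin m → Fin m → K} {l : Ω → ℝ}
    (hX : IsGaussianMatrix coord X μ) (hG : Measurable G)
    (hXG : IndepFun (fun ω => realCoords coord (X ω)) G μ)
    (hBm : Measurable B) (hB : ∀ᵐ ω ∂μ, IsRankOne (of (B (G ω))) (l ω)) :
    ∃ (x : Fin (min m n) → Ω → ℝ) (y : Fin (min (m - 1) n) → Ω → ℝ),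
      IsChiFamily d x y μ ∧
      IndepFun (fun ω => (fun j => x j ω, fun j => y j ω)) G μ ∧
      ∀ᵐ ω ∂μ, ∃ U ∈ unitary (Matrix (Fin (m + n)) (Fin (m + n)) K),
        U * reindex finSumFinEquiv finSumFinEquiv (chiralBlock (X ω)) * Uᴴ =
          triJ (m + n) (offDiag (fun j => x j ω) (fun j => y j ω)) ∧
        U * reindex finSumFinEquiv finSumFinEquiv (fromBlocks (of (B (G ω))) 0 0 0) * Uᴴ =
          corner (m + n) (l ω) := by
  obtain ⟨hm, hl, hi⟩ := hX
  have hXc : (fun ω => of.symm (X ω)) = ofCoords e m n ∘ fun ω => realCoords coord (X ω) := by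
    ext ω i j
    simp only [Function.comp_apply, ofCoords, realCoords, he, of_symm_apply]
    exact (e.symm_apply_apply (X ω i j)).symm
  have hcm : Measurable fun ω => realCoords coord (X ω) := measurable_pi_iff.2 hm
  have hlaw : μ.map (fun ω => of.symm (X ω)) = gaussMat K m n := by
    rw [hXc, ← Measure.map_map (measurable_ofCoords e m n) hcm, ← map_ofCoords e]
    congr 1
    refine ((iIndepFun_iff_map_fun_eq_pi_map fun p => (hm p).aemeasurable).1 hi).trans ?_
    congr 1
    ext1 p
    exact (hl p).map_eq
  have hd : Module.finrank ℝ K = d := by rw [e.toLinearEquiv.finrank_eq, finrank_euclideanSpace_fin]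
  have hind : IndepFun (fun ω => of.symm (X ω)) G μ := by
    rw [hXc]
    exact hXG.comp (measurable_ofCoords e m n) measurable_id
  have hmeas : Measurable fun ω => of.symm (X ω) := by
    rw [hXc]
    exact (measurable_ofCoords e m n).comp hcm
  have := exists_chiFamily hmeas hlaw hG hind hBm hB
  rw [hd] at this
  exact this

end Coordinates

/-! ### Rank one as an outer product -/

section Outer

/-- The minor identity needs `w k * u k = u k * w k`. This holds over ℍ too: the right side is a
real `r`, so if `u k ≠ 0` then `w k = r • (u k)⁻¹`, which commutes with `u k`. -/
lemma IsRankOne.of_outer {m : ℕ} {B : Matrix (Fin m) (Fin m) K} {l : ℝ}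
    (h1 : ∀ j k, star (B j k) = B k j) (h2 : ∀ k, ∃ r : ℝ, 0 ≤ r ∧ B k k = r • (1 : K))
    (h3 : B ≠ 0) (h4 : ∃ u w : Fin m → K, ∀ i j, B i j = u i * w j) (h5 : hsNorm B = l) :
    IsRankOne B l := by
  refine ⟨h1, h2, h3, fun i j k => ?_, h5⟩
  obtain ⟨u, w, h⟩ := h4
  obtain ⟨r, -, hr⟩ := h2 k
  rw [hr, h i k, h k j, h i j]
  have hk : u k * w k = r • (1 : K) := by rw [← h, hr]
  by_cases huk : u k = 0
  · have : r • (1 : K) = 0 := by rw [← hk, huk, zero_mul]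
    rw [this, huk, zero_mul, mul_zero, zero_mul]
  · have hwk : w k * u k = r • (1 : K) := by
      have : w k = r • (u k)⁻¹ := by
        rw [← inv_mul_cancel_left₀ huk (w k), hk, mul_smul_comm, mul_one]
      rw [this, smul_mul_assoc, inv_mul_cancel₀ huk]
    rw [mul_assoc, ← mul_assoc (w k), hwk, smul_mul_assoc, one_mul, mul_smul_comm, smul_mul_assoc,
      one_mul]

end Outer

/-- A division ring is allowed because the columns of a quaternionic matrix span a space over
`ℍᵐᵒᵖ`. -/
lemma exists_smul_eq_of_finrank_span_eq_one {R V ι : Type*} [DivisionRing R] [AddCommGroup V]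
    [Module R V] {f : ι → V} (h : Module.finrank R (Submodule.span R (Set.range f)) = 1) :
    ∃ u : V, ∀ i, ∃ c : R, f i = c • u := by
  obtain ⟨v, -, hv⟩ := finrank_eq_one_iff'.1 h
  refine ⟨v, fun i => ?_⟩
  obtain ⟨c, hc⟩ := hv ⟨f i, Submodule.subset_span ⟨i, rfl⟩⟩
  exact ⟨c, (congrArg Subtype.val hc).symm⟩

end

/-! ### The complex and real cases -/

noncomputable section

instance : NormStar ℝ := ⟨fun a => by simp [sq]⟩

instance : NormStar ℂ := ⟨fun a => by simpa using Complex.conj_mul' a⟩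

/-- The real line as a one-dimensional Euclidean space. -/
def realIsometry : ℝ ≃ₗᵢ[ℝ] EuclideanSpace ℝ (Fin 1) where
  toFun a := WithLp.toLp 2 fun _ => a
  invFun f := f 0
  map_add' _ _ := rfl
  map_smul' _ _ := rfl
  left_inv _ := rfl
  right_inv f := by
    ext i
    fin_cases i
    rfl
  norm_map' a := by
    change ‖(WithLp.toLp 2 fun _ : Fin 1 => a)‖ = ‖a‖
    simp [EuclideanSpace.norm_eq, Real.sqrt_sq_eq_abs]

lemma complex_eq_smul_one_of_nonneg {z : ℂ} (h : 0 ≤ z) : ∃ r : ℝ, 0 ≤ r ∧ z = r • (1 : ℂ) := by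
  obtain ⟨h1, h2⟩ := Complex.nonneg_iff.1 h
  exact ⟨z.re, h1, Complex.ext (by simp) (by simp [← h2])⟩

lemma exists_outer_of_rank_eq_one {m : ℕ} {A : Matrix (Fin m) (Fin m) ℂ} (h : A.rank = 1) :
    ∃ u w : Fin m → ℂ, ∀ i j, A i j = u i * w j := by
  rw [Matrix.rank_eq_finrank_span_cols] at h
  obtain ⟨u, hu⟩ := exists_smul_eq_of_finrank_span_eq_one h
  choose w hw using hu
  refine ⟨u, w, fun i j => ?_⟩
  have := congrFun (hw j) i
  rw [mul_comm]
  exact this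

lemma isRankOne_complex {m : ℕ} {Γ : Matrix (Fin m) (Fin m) ℂ} {l : ℝ}
    (h1 : (-Complex.I • Γ).PosSemidef) (h2 : Γ.rank = 1) (h3 : hsNorm Γ = l) :
    IsRankOne (-Complex.I • Γ) l := by
  refine .of_outer (fun j k => h1.isHermitian.apply k j)
    (fun k => complex_eq_smul_one_of_nonneg h1.diag_nonneg) ?_ ?_ ?_
  · intro h
    have : Γ = 0 := by simpa using h
    simp [this] at h2
  · obtain ⟨u, w, h⟩ := exists_outer_of_rank_eq_one h2
    exact ⟨fun i => -Complex.I * u i, w, fun i j => by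
      rw [Matrix.smul_apply, h, smul_eq_mul, mul_assoc]⟩
  · rw [← h3]
    simp [hsNorm]

lemma chiralJ_eq {m n : ℕ} (x : Fin (min m n) → ℝ) (y : Fin (min (m - 1) n) → ℝ) :
    chiralJ x y = triJ (m + n) (offDiag x y) := by
  ext i j
  simp [chiralJ, triJ]

lemma chiralJPert_eq {m n : ℕ} (x : Fin (min m n) → ℝ) (y : Fin (min (m - 1) n) → ℝ) (l : ℝ) :
    chiralJPert x y l =
      triJ (m + n) (offDiag x y) + Complex.I • (corner (m + n) l : Matrix _ _ ℂ) := by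
  ext i j
  simp only [chiralJPert, chiralJ_eq, Matrix.add_apply, Matrix.map_apply, Matrix.smul_apply,
    cornerUnit, corner, triJ, of_apply]
  split_ifs <;> simp

lemma chiralPert_eq {m n : ℕ} (B : Matrix (Fin m) (Fin m) ℂ) (X : Matrix (Fin m) (Fin n) ℂ) :
    chiralPert (Complex.I • B) X = reindex finSumFinEquiv finSumFinEquiv (chiralBlock X) +
      Complex.I • reindex finSumFinEquiv finSumFinEquiv (fromBlocks B 0 0 0) := by
  ext i j
  obtain ⟨i, rfl⟩ := finSumFinEquiv.surjective i
  obtain ⟨j, rfl⟩ := finSumFinEquiv.surjective j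
  rcases i with i | i <;> rcases j with j | j <;> simp [chiralPert, chiralBlock]

lemma conj_add_smul {ι κ : Type*} [Fintype ι] [Fintype κ] (U : Matrix κ ι ℂ)
    (M N : Matrix ι ι ℂ) :
    U * (M + Complex.I • N) * Uᴴ = U * M * Uᴴ + Complex.I • (U * N * Uᴴ) := by
  simp [Matrix.mul_add, Matrix.add_mul]

lemma ofReal_conj {ι κ : Type*} [Fintype ι] [Fintype κ] (U : Matrix κ ι ℝ) (M : Matrix ι ι ℝ) :
    U.map Complex.ofReal * M.map Complex.ofReal * (U.map Complex.ofReal)ᴴ =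
      (U * M * Uᴴ).map Complex.ofReal := by
  ext i j
  simp [Matrix.mul_apply]

theorem exists_chiFamily_tridiagonal_complex {Ω : Type*} [MeasurableSpace Ω] (μ : Measure Ω)
    [IsProbabilityMeasure μ] (m n : ℕ)
    (X : Ω → Matrix (Fin m) (Fin n) ℂ) (Γ : Ω → Matrix (Fin m) (Fin m) ℂ) (l : Ω → ℝ)
    (hX : IsGaussianMatrix coordComplex X μ)
    (hΓm : ∀ j k, Measurable fun ω => Γ ω j k)
    (hind : IndepFun (fun ω => realCoords coordComplex (X ω))
      (fun ω (p : Fin m × Fin m) => Γ ω p.1 p.2) μ)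
    (hΓ : ∀ᵐ ω ∂μ, (Γ ω)ᴴ = -Γ ω ∧ (-Complex.I • Γ ω).PosSemidef ∧ (Γ ω).rank = 1 ∧
      hsNorm (Γ ω) = l ω) :
    ∃ (x : Fin (min m n) → Ω → ℝ) (y : Fin (min (m - 1) n) → Ω → ℝ),
      IsChiFamily 2 x y μ ∧
      IndepFun (fun ω => (fun j => x j ω, fun j => y j ω))
        (fun ω (p : Fin m × Fin m) => Γ ω p.1 p.2) μ ∧
      ∀ᵐ ω ∂μ, ∃ U ∈ unitary (Matrix (Fin (m + n)) (Fin (m + n)) ℂ),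
        U * chiralPert (Γ ω) (X ω) * Uᴴ =
          chiralJPert (fun j => x j ω) (fun j => y j ω) (l ω) := by
  have hBm : Measurable fun (t : Fin m × Fin m → ℂ) (j k : Fin m) => -Complex.I * t (j, k) := by
    fun_prop
  obtain ⟨x, y, h1, h2, h3⟩ := exists_chiFamily_of_isGaussianMatrix (l := l)
    (B := fun (t : Fin m × Fin m → ℂ) (j k : Fin m) => -Complex.I * t (j, k))
    (G := fun ω (p : Fin m × Fin m) => Γ ω p.1 p.2)
    Complex.orthonormalBasisOneI.repr
    (fun t a => by fin_cases t <;> simp [coordComplex]) hX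
    (measurable_pi_iff.2 fun p => hΓm p.1 p.2) hind hBm (by
      filter_upwards [hΓ] with ω hω
      exact isRankOne_complex hω.2.1 hω.2.2.1 hω.2.2.2)
  refine ⟨x, y, by exact_mod_cast h1, h2, ?_⟩
  filter_upwards [h3] with ω ⟨U, hU, hU1, hU2⟩
  refine ⟨U, hU, ?_⟩
  have hΓB : Γ ω = Complex.I • of fun j k => -Complex.I * Γ ω j k := by
    ext j k
    simp [← mul_assoc]
  rw [hΓB, chiralPert_eq, conj_add_smul, hU1, hU2, chiralJPert_eq]

theorem exists_chiFamily_tridiagonal_real {Ω : Type*} [MeasurableSpace Ω] (μ : Measure Ω)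
    [IsProbabilityMeasure μ] (m n : ℕ)
    (X : Ω → Matrix (Fin m) (Fin n) ℝ) (Γ : Ω → Matrix (Fin m) (Fin m) ℂ) (l : Ω → ℝ)
    (hX : IsGaussianMatrix coordReal X μ)
    (hΓm : ∀ j k, Measurable fun ω => Γ ω j k)
    (hind : IndepFun (fun ω => realCoords coordReal (X ω))
      (fun ω (p : Fin m × Fin m) => Γ ω p.1 p.2) μ)
    (hΓ : ∀ᵐ ω ∂μ, (Γ ω)ᴴ = -Γ ω ∧ (-Complex.I • Γ ω).PosSemidef ∧ (Γ ω).rank = 1 ∧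
      hsNorm (Γ ω) = l ω ∧
      ∃ A : Matrix (Fin m) (Fin m) ℝ, Complex.I • Γ ω = A.map Complex.ofReal) :
    ∃ (x : Fin (min m n) → Ω → ℝ) (y : Fin (min (m - 1) n) → Ω → ℝ),
      IsChiFamily 1 x y μ ∧
      IndepFun (fun ω => (fun j => x j ω, fun j => y j ω))
        (fun ω (p : Fin m × Fin m) => Γ ω p.1 p.2) μ ∧
      ∀ᵐ ω ∂μ, ∃ U ∈ unitary (Matrix (Fin (m + n)) (Fin (m + n)) ℝ),
        U.map Complex.ofReal * chiralPert (Γ ω) ((X ω).map Complex.ofReal) *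
            (U.map Complex.ofReal)ᴴ =
          chiralJPert (fun j => x j ω) (fun j => y j ω) (l ω) := by
  -- The real part is defined and measurable for every value of `Γ`; almost surely `-iΓ` is real and
  -- equals it.
  have hBm : Measurable fun (t : Fin m × Fin m → ℂ) (j k : Fin m) =>
      (-Complex.I * t (j, k)).re := by
    fun_prop
  have hmap : ∀ᵐ ω ∂μ, -Complex.I • Γ ω =
      (of fun j k => (-Complex.I * Γ ω j k).re).map Complex.ofReal := by
    filter_upwards [hΓ] with ω hω
    obtain ⟨A, hA⟩ := hω.2.2.2.2
    have hA' : ∀ j k, Complex.I * Γ ω j k = A j k := fun j k => congrFun (congrFun hA j) k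
    ext j k
    simp only [Matrix.smul_apply, smul_eq_mul, neg_mul, hA', Matrix.map_apply, of_apply]
    simp
  obtain ⟨x, y, h1, h2, h3⟩ := exists_chiFamily_of_isGaussianMatrix (l := l)
    (B := fun (t : Fin m × Fin m → ℂ) (j k : Fin m) => (-Complex.I * t (j, k)).re)
    (G := fun ω (p : Fin m × Fin m) => Γ ω p.1 p.2)
    realIsometry (fun t a => by fin_cases t; rfl) hX
    (measurable_pi_iff.2 fun p => hΓm p.1 p.2) hind hBm (by
      filter_upwards [hΓ, hmap] with ω hω hB
      have h := isRankOne_complex hω.2.1 hω.2.2.1 hω.2.2.2.1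
      rw [hB] at h
      refine ⟨fun j k => Complex.ofReal_injective ?_, fun k => ?_, ?_, fun i j k =>
        Complex.ofReal_injective ?_, ?_⟩
      · simpa using h.isHermitian j k
      · obtain ⟨r, hr, hk⟩ := h.diag_nonneg k
        exact ⟨r, hr, Complex.ofReal_injective (by simpa using hk)⟩
      · intro h0
        exact h.ne_zero (by rw [h0]; simp)
      · simpa using h.minor i j k
      · rw [← h.norm_eq]
        simp [hsNorm])
  refine ⟨x, y, by exact_mod_cast h1, h2, ?_⟩
  filter_upwards [h3, hmap] with ω ⟨U, hU, hU1, hU2⟩ hB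
  refine ⟨U, hU, ?_⟩
  have hΓB : Γ ω = Complex.I •
      (of fun j k => (-Complex.I * Γ ω j k).re).map Complex.ofReal := by
    rw [← hB, smul_smul]
    simp
  have e1 : reindex finSumFinEquiv finSumFinEquiv (chiralBlock ((X ω).map Complex.ofReal)) =
      (reindex finSumFinEquiv finSumFinEquiv (chiralBlock (X ω))).map Complex.ofReal := by
    ext i j
    obtain ⟨i, rfl⟩ := finSumFinEquiv.surjective i
    obtain ⟨j, rfl⟩ := finSumFinEquiv.surjective j
    rcases i with i | i <;> rcases j with j | j <;> simp [chiralBlock]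
  have e2 : ∀ B : Matrix (Fin m) (Fin m) ℝ,
      (reindex finSumFinEquiv finSumFinEquiv (fromBlocks (B.map Complex.ofReal) 0 0 0) :
        Matrix (Fin (m + n)) (Fin (m + n)) ℂ) =
      (reindex finSumFinEquiv finSumFinEquiv (fromBlocks B 0 0 0)).map Complex.ofReal := by
    intro B
    ext i j
    obtain ⟨i, rfl⟩ := finSumFinEquiv.surjective i
    obtain ⟨j, rfl⟩ := finSumFinEquiv.surjective j
    rcases i with i | i <;> rcases j with j | j <;> simp
  rw [hΓB, chiralPert_eq, conj_add_smul, e1, e2, ofReal_conj, ofReal_conj, hU1, hU2,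
    chiralJPert_eq]
  ext i j
  simp only [Matrix.add_apply, Matrix.map_apply, Matrix.smul_apply, corner, triJ, of_apply]
  split_ifs <;> simp

/-! ### The quaternionic case -/

instance : StarModule ℝ ℍ[ℝ] := ⟨fun r a => by ext <;> simp⟩

instance : NormStar ℍ[ℝ] := ⟨fun a => by
  rw [Quaternion.star_mul_self, Quaternion.normSq_eq_norm_mul_self, ← sq]
  generalize ‖a‖ ^ 2 = r
  ext <;> simp⟩

instance : MeasurableSpace ℍ[ℝ] := borel _

instance : BorelSpace ℍ[ℝ] := ⟨rfl⟩

instance : FiniteDimensional ℝ ℍ[ℝ] :=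
  Quaternion.linearIsometryEquivTuple.symm.toLinearEquiv.finiteDimensional

instance : SecondCountableTopology ℍ[ℝ] :=
  Quaternion.linearIsometryEquivTuple.toHomeomorph.secondCountableTopology

section QuatMat

variable {ι κ τ : Type*}

lemma quatBlock_add (p q : ℍ[ℝ]) : quatBlock (p + q) = quatBlock p + quatBlock q := by
  ext a b
  fin_cases a <;> fin_cases b <;> apply Complex.ext <;> simp [quatBlock] <;> ring

lemma quatBlock_mul (p q : ℍ[ℝ]) : quatBlock (p * q) = quatBlock p * quatBlock q := by
  ext a b
  fin_cases a <;> fin_cases b <;> apply Complex.ext <;>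
    simp [quatBlock, Matrix.mul_apply] <;> ring

lemma quatBlock_star (p : ℍ[ℝ]) : quatBlock (star p) = (quatBlock p)ᴴ := by
  ext a b
  fin_cases a <;> fin_cases b <;> apply Complex.ext <;> simp [quatBlock]

lemma quatBlock_smul_one (r : ℝ) : quatBlock (r • (1 : ℍ[ℝ])) = (r : ℂ) • 1 := by
  ext a b
  fin_cases a <;> fin_cases b <;> apply Complex.ext <;> simp [quatBlock]

lemma quatBlock_zero : quatBlock 0 = 0 := by
  ext a b
  fin_cases a <;> fin_cases b <;> apply Complex.ext <;> simp [quatBlock]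

lemma quatBlock_neg (p : ℍ[ℝ]) : quatBlock (-p) = -quatBlock p := by
  ext a b
  fin_cases a <;> fin_cases b <;> apply Complex.ext <;> simp [quatBlock]

lemma quatBlock_sum {σ : Type*} (s : Finset σ) (f : σ → ℍ[ℝ]) :
    quatBlock (∑ i ∈ s, f i) = ∑ i ∈ s, quatBlock (f i) :=
  map_sum (⟨⟨quatBlock, quatBlock_zero⟩, quatBlock_add⟩ : ℍ[ℝ] →+ Matrix (Fin 2) (Fin 2) ℂ) f s

lemma quatMat_mul [Fintype κ] (A : Matrix ι κ ℍ[ℝ]) (B : Matrix κ τ ℍ[ℝ]) :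
    quatMat (A * B) = quatMat A * quatMat B := by
  ext p q
  simp only [quatMat, of_apply, Matrix.mul_apply, quatBlock_sum, Matrix.sum_apply, quatBlock_mul,
    Fintype.sum_prod_type]

lemma quatMat_conjTranspose (A : Matrix ι κ ℍ[ℝ]) : quatMat Aᴴ = (quatMat A)ᴴ := by
  ext p q
  simp [quatMat, quatBlock_star]

lemma quatMat_neg (A : Matrix ι κ ℍ[ℝ]) : quatMat (-A) = -quatMat A := by
  ext p q
  simp [quatMat, quatBlock_neg]

lemma quatMat_conj [Fintype ι] (U : Matrix κ ι ℍ[ℝ]) (M : Matrix ι ι ℍ[ℝ]) :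
    quatMat U * quatMat M * (quatMat U)ᴴ = quatMat (U * M * Uᴴ) := by
  rw [quatMat_mul, quatMat_mul, quatMat_conjTranspose]

lemma quatMat_triJ (N : ℕ) (z : ℕ → ℝ) :
    quatMat (triJ N z) = (triJ N z : Matrix _ _ ℂ) ⊗ₖ (1 : Matrix (Fin 2) (Fin 2) ℂ) := by
  ext p q
  simp only [quatMat, triJ, of_apply, kroneckerMap_apply, quatBlock_smul_one]
  split_ifs <;> simp

lemma quatMat_corner (N : ℕ) (l : ℝ) :
    quatMat (corner N l) = (corner N l : Matrix _ _ ℂ) ⊗ₖ (1 : Matrix (Fin 2) (Fin 2) ℂ) := by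
  ext p q
  simp only [quatMat, corner, of_apply, kroneckerMap_apply]
  split_ifs
  · simp [quatBlock_smul_one]
  · simp [quatBlock_zero]

lemma chiralPertQuat_eq {m n : ℕ} (B : Matrix (Fin m) (Fin m) ℍ[ℝ])
    (X : Matrix (Fin m) (Fin n) ℍ[ℝ]) :
    chiralPertQuat (Complex.I • quatMat B) X =
      quatMat (reindex finSumFinEquiv finSumFinEquiv (chiralBlock X)) +
      Complex.I • quatMat (reindex finSumFinEquiv finSumFinEquiv (fromBlocks B 0 0 0)) := by
  ext ⟨i, a⟩ ⟨j, b⟩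
  obtain ⟨i, rfl⟩ := finSumFinEquiv.surjective i
  obtain ⟨j, rfl⟩ := finSumFinEquiv.surjective j
  rcases i with i | i <;> rcases j with j | j <;>
    simp [chiralPertQuat, chiralBlock, quatMat, quatBlock_zero]

/-- The quaternion whose first row as a complex matrix is `(z, w)`. -/
def ofFirstRow (z w : ℂ) : ℍ[ℝ] := ⟨z.re, z.im, w.re, w.im⟩

lemma measurable_ofFirstRow : Measurable fun p : ℂ × ℂ => ofFirstRow p.1 p.2 := by
  have h : (fun p : ℂ × ℂ => ofFirstRow p.1 p.2) = Quaternion.linearIsometryEquivTuple.symm ∘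
      fun p : ℂ × ℂ => !₂[p.1.re, p.1.im, p.2.re, p.2.im] := by
    ext p <;> simp [ofFirstRow]
  rw [h]
  exact (Quaternion.linearIsometryEquivTuple.symm.continuous.comp (by fun_prop)).measurable

lemma ofFirstRow_quatBlock (q : ℍ[ℝ]) :
    ofFirstRow (quatBlock q 0 0) (quatBlock q 0 1) = q := by
  ext <;> simp [ofFirstRow, quatBlock]

/-- The columns are right multiples of one vector `u`, which puts the factor `w j` on the correct
side. -/
lemma exists_outer_of_quatRank_eq_one {m : ℕ} {A : Matrix (Fin m) (Fin m) ℍ[ℝ]}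
    (h : quatRank A = 1) : ∃ u w : Fin m → ℍ[ℝ], ∀ i j, A i j = u i * w j := by
  obtain ⟨u, hu⟩ := exists_smul_eq_of_finrank_span_eq_one h
  choose w hw using hu
  exact ⟨u, fun j => (w j).unop, fun i j => congrFun (hw j) i⟩

lemma isRankOne_quat {m : ℕ} {A : Matrix (Fin m) (Fin m) ℍ[ℝ]} {l : ℝ}
    (h1 : (quatMat (-A)).PosSemidef) (h2 : quatRank A = 1) (h3 : hsNorm A = l) :
    IsRankOne (-A) l := by
  have hherm : ∀ j k, star ((-A) j k) = (-A) k j := by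
    intro j k
    have e1 := h1.isHermitian
    rw [Matrix.IsHermitian, ← quatMat_conjTranspose] at e1
    have e2 : ∀ a b, quatBlock (star ((-A) j k)) a b = quatBlock ((-A) k j) a b := fun a b =>
      congrFun (congrFun e1 (k, a)) (j, b)
    rw [← ofFirstRow_quatBlock (star ((-A) j k)), e2, e2, ofFirstRow_quatBlock]
  refine .of_outer hherm (fun k => ?_) ?_ ?_ ?_
  -- A diagonal entry equals its own conjugate, so its imaginary parts vanish; its real part is that
  -- of a diagonal entry of the complex matrix.
  · have hd : 0 ≤ quatMat (-A) (k, 0) (k, 0) := h1.diag_nonneg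
    have hre : 0 ≤ ((-A) k k).re := (Complex.nonneg_iff.1 hd).1
    have hk := hherm k k
    refine ⟨_, hre, ?_⟩
    have hi := congrArg QuaternionAlgebra.imI hk
    have hj := congrArg QuaternionAlgebra.imJ hk
    have hkk := congrArg QuaternionAlgebra.imK hk
    simp only [Quaternion.imI_star, Quaternion.imJ_star, Quaternion.imK_star] at hi hj hkk
    ext
    · simp
    · simp only [Quaternion.imI_smul, Quaternion.imI_one, smul_zero]; linarith
    · simp only [Quaternion.imJ_smul, Quaternion.imJ_one, smul_zero]; linarith
    · simp only [Quaternion.imK_smul, Quaternion.imK_one, smul_zero]; linarith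
  · intro h
    obtain rfl : A = 0 := by simpa using h
    have : Set.range (fun (k : Fin m) (j : Fin m) => (0 : Matrix (Fin m) (Fin m) ℍ[ℝ]) j k) ⊆ {0} := by
      rintro _ ⟨k, rfl⟩
      rfl
    rw [quatRank, Submodule.span_eq_bot.2 this, finrank_bot] at h2
    exact zero_ne_one h2
  · obtain ⟨u, w, h⟩ := exists_outer_of_quatRank_eq_one h2
    exact ⟨fun i => -u i, w, fun i j => by rw [Matrix.neg_apply, h, neg_mul]⟩
  · rw [← h3]
    simp [hsNorm]

end QuatMat

theorem exists_chiFamily_tridiagonal_quat {Ω : Type*} [MeasurableSpace Ω] (μ : Measure Ω)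
    [IsProbabilityMeasure μ] (m n : ℕ)
    (X : Ω → Matrix (Fin m) (Fin n) ℍ[ℝ])
    (Γ : Ω → Matrix (Fin m × Fin 2) (Fin m × Fin 2) ℂ) (l : Ω → ℝ)
    (hX : IsGaussianMatrix coordQuat X μ)
    (hΓm : ∀ p q, Measurable fun ω => Γ ω p q)
    (hind : IndepFun (fun ω => realCoords coordQuat (X ω))
      (fun ω (p : (Fin m × Fin 2) × (Fin m × Fin 2)) => Γ ω p.1 p.2) μ)
    (hΓ : ∀ᵐ ω ∂μ, (Γ ω)ᴴ = -Γ ω ∧ (-Complex.I • Γ ω).PosSemidef ∧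
      ∃ A : Matrix (Fin m) (Fin m) ℍ[ℝ],
        Complex.I • Γ ω = quatMat A ∧ quatRank A = 1 ∧ hsNorm A = l ω) :
    ∃ (x : Fin (min m n) → Ω → ℝ) (y : Fin (min (m - 1) n) → Ω → ℝ),
      IsChiFamily 4 x y μ ∧
      IndepFun (fun ω => (fun j => x j ω, fun j => y j ω))
        (fun ω (p : (Fin m × Fin 2) × (Fin m × Fin 2)) => Γ ω p.1 p.2) μ ∧
      ∀ᵐ ω ∂μ, ∃ U ∈ unitary (Matrix (Fin (m + n)) (Fin (m + n)) ℍ[ℝ]),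
        quatMat U * chiralPertQuat (Γ ω) (X ω) * (quatMat U)ᴴ =
          chiralJPert (fun j => x j ω) (fun j => y j ω) (l ω) ⊗ₖ
            (1 : Matrix (Fin 2) (Fin 2) ℂ) := by
  -- Reading each quaternion off the first row of its `2 × 2` block gives a measurable function of
  -- `Γ` without any choice of `A`; almost surely it returns `-A`.
  let B : ((Fin m × Fin 2) × (Fin m × Fin 2) → ℂ) → Fin m → Fin m → ℍ[ℝ] := fun t j k =>
    ofFirstRow (-Complex.I * t ((j, 0), (k, 0))) (-Complex.I * t ((j, 0), (k, 1)))
  have hBm : Measurable B := by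
    refine measurable_pi_iff.2 fun j => measurable_pi_iff.2 fun k => ?_
    exact measurable_ofFirstRow.comp (by fun_prop : Measurable
      fun t : (Fin m × Fin 2) × (Fin m × Fin 2) → ℂ =>
        (-Complex.I * t ((j, 0), (k, 0)), -Complex.I * t ((j, 0), (k, 1))))
  have hB : ∀ᵐ ω ∂μ, -Complex.I • Γ ω = quatMat (of (B fun p => Γ ω p.1 p.2)) ∧
      IsRankOne (of (B fun p => Γ ω p.1 p.2)) (l ω) := by
    filter_upwards [hΓ] with ω ⟨_, hpos, A, hA, hrank, hnorm⟩
    have hA' : -Complex.I • Γ ω = quatMat (-A) := by rw [quatMat_neg, ← hA, neg_smul]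
    have hBA : of (B fun p => Γ ω p.1 p.2) = -A := by
      ext1 j k
      have e : ∀ a b, -Complex.I * Γ ω (j, a) (k, b) = quatBlock ((-A) j k) a b := fun a b =>
        congrFun (congrFun hA' (j, a)) (k, b)
      simp only [B, of_apply, e]
      exact ofFirstRow_quatBlock _
    rw [hBA]
    exact ⟨hA', isRankOne_quat (hA' ▸ hpos) hrank hnorm⟩
  obtain ⟨x, y, h1, h2, h3⟩ := exists_chiFamily_of_isGaussianMatrix (l := l) (B := B)
    (G := fun ω (p : (Fin m × Fin 2) × (Fin m × Fin 2)) => Γ ω p.1 p.2)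
    Quaternion.linearIsometryEquivTuple
    (fun t a => by fin_cases t <;> simp [coordQuat]) hX
    (measurable_pi_iff.2 fun p => hΓm p.1 p.2) hind hBm (hB.mono fun ω hω => hω.2)
  refine ⟨x, y, by exact_mod_cast h1, h2, ?_⟩
  filter_upwards [h3, hB] with ω ⟨U, hU, hU1, hU2⟩ ⟨hΓB, _⟩
  refine ⟨U, hU, ?_⟩
  have hΓB' : Γ ω = Complex.I • quatMat (of (B fun p => Γ ω p.1 p.2)) := by
    rw [← hΓB, smul_smul]
    simp
  conv_lhs => rw [hΓB']
  rw [chiralPertQuat_eq, conj_add_smul, quatMat_conj, quatMat_conj, hU1, hU2, chiralJPert_eq,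
    quatMat_triJ, quatMat_corner, add_kronecker, smul_kronecker]

end

end NormStar

theorem mainTheorem7 {Ω : Type*} [MeasurableSpace Ω] (μ : Measure Ω) [IsProbabilityMeasure μ]
    (m n : ℕ) :
    -- real entries, `β = 1`
    (∀ (X : Ω → Matrix (Fin m) (Fin n) ℝ) (Γ : Ω → Matrix (Fin m) (Fin m) ℂ) (l : Ω → ℝ),
      IsGaussianMatrix coordReal X μ →
      (∀ j k, Measurable fun ω => Γ ω j k) →
      IndepFun (fun ω => realCoords coordReal (X ω))
        (fun ω (p : Fin m × Fin m) => Γ ω p.1 p.2) μ →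
      (∀ᵐ ω ∂μ, (Γ ω)ᴴ = -Γ ω ∧ (-Complex.I • Γ ω).PosSemidef ∧ (Γ ω).rank = 1 ∧
        hsNorm (Γ ω) = l ω ∧
        ∃ A : Matrix (Fin m) (Fin m) ℝ, Complex.I • Γ ω = A.map Complex.ofReal) →
      ∃ (x : Fin (min m n) → Ω → ℝ) (y : Fin (min (m - 1) n) → Ω → ℝ),
        IsChiFamily 1 x y μ ∧
        IndepFun (fun ω => (fun j => x j ω, fun j => y j ω))
          (fun ω (p : Fin m × Fin m) => Γ ω p.1 p.2) μ ∧
        ∀ᵐ ω ∂μ, ∃ U ∈ unitary (Matrix (Fin (m + n)) (Fin (m + n)) ℝ),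
          U.map Complex.ofReal * chiralPert (Γ ω) ((X ω).map Complex.ofReal) *
              (U.map Complex.ofReal)ᴴ =
            chiralJPert (fun j => x j ω) (fun j => y j ω) (l ω)) ∧
    -- complex entries, `β = 2`
    (∀ (X : Ω → Matrix (Fin m) (Fin n) ℂ) (Γ : Ω → Matrix (Fin m) (Fin m) ℂ) (l : Ω → ℝ),
      IsGaussianMatrix coordComplex X μ →
      (∀ j k, Measurable fun ω => Γ ω j k) →
      IndepFun (fun ω => realCoords coordComplex (X ω))
        (fun ω (p : Fin m × Fin m) => Γ ω p.1 p.2) μ →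
      (∀ᵐ ω ∂μ, (Γ ω)ᴴ = -Γ ω ∧ (-Complex.I • Γ ω).PosSemidef ∧ (Γ ω).rank = 1 ∧
        hsNorm (Γ ω) = l ω) →
      ∃ (x : Fin (min m n) → Ω → ℝ) (y : Fin (min (m - 1) n) → Ω → ℝ),
        IsChiFamily 2 x y μ ∧
        IndepFun (fun ω => (fun j => x j ω, fun j => y j ω))
          (fun ω (p : Fin m × Fin m) => Γ ω p.1 p.2) μ ∧
        ∀ᵐ ω ∂μ, ∃ U ∈ unitary (Matrix (Fin (m + n)) (Fin (m + n)) ℂ),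
          U * chiralPert (Γ ω) (X ω) * Uᴴ =
            chiralJPert (fun j => x j ω) (fun j => y j ω) (l ω)) ∧
    -- quaternionic entries, `β = 4`
    (∀ (X : Ω → Matrix (Fin m) (Fin n) ℍ[ℝ])
      (Γ : Ω → Matrix (Fin m × Fin 2) (Fin m × Fin 2) ℂ) (l : Ω → ℝ),
      IsGaussianMatrix coordQuat X μ →
      (∀ p q, Measurable fun ω => Γ ω p q) →
      IndepFun (fun ω => realCoords coordQuat (X ω))
        (fun ω (p : (Fin m × Fin 2) × (Fin m × Fin 2)) => Γ ω p.1 p.2) μ →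
      (∀ᵐ ω ∂μ, (Γ ω)ᴴ = -Γ ω ∧ (-Complex.I • Γ ω).PosSemidef ∧
        ∃ A : Matrix (Fin m) (Fin m) ℍ[ℝ],
          Complex.I • Γ ω = quatMat A ∧ quatRank A = 1 ∧ hsNorm A = l ω) →
      ∃ (x : Fin (min m n) → Ω → ℝ) (y : Fin (min (m - 1) n) → Ω → ℝ),
        IsChiFamily 4 x y μ ∧
        IndepFun (fun ω => (fun j => x j ω, fun j => y j ω))
          (fun ω (p : (Fin m × Fin 2) × (Fin m × Fin 2)) => Γ ω p.1 p.2) μ ∧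
        ∀ᵐ ω ∂μ, ∃ U ∈ unitary (Matrix (Fin (m + n)) (Fin (m + n)) ℍ[ℝ]),
          quatMat U * chiralPertQuat (Γ ω) (X ω) * (quatMat U)ᴴ =
            chiralJPert (fun j => x j ω) (fun j => y j ω) (l ω) ⊗ₖ
              (1 : Matrix (Fin 2) (Fin 2) ℂ)) := by
  exact ⟨NormStar.exists_chiFamily_tridiagonal_real μ m n, NormStar.exists_chiFamily_tridiagonal_complex μ m n,
    NormStar.exists_chiFamily_tridiagonal_quat μ m n⟩
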